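/- For integers $k$, $m\neq 0$ and $n\ge 0$ let $(x|y)_{k,m,n}=x\cdot y+\frac{k-m}{m^2}\,\mathrm{lat}(x)\,\mathrm{lat}(y)$ on $\mathbb{Q}^n$, where $\mathrm{lat}(x)=x_1+\cdots+x_n$, and let $L_{k,m,n}=\{x\in\mathbb{Z}^n : m\mid \mathrm{lat}(x)\}$ with this form. Its roots are the $a\in L_{k,m,n}$ with $(a|a)=2$, and its Weyl group is the group of linear automorphisms of $\mathbb{Q}^n$ generated by the reflections $s_a\colon x\mapsto x-(a|x)a$ in the roots $a$. Put $X_n=L_{2,m,n}$ and let $W(X_n)$ be its Weyl group; here $X_n=A_n$ for $m=1$, $n\ge 1$; $X_n=D_n$ for $m=2$, $n\ge 2$; $X_n=E_n$ for $m=3$, $3\le n\le 8$. Let $z_n=(m-2)(e_1+\cdots+e_n)+(\det X_n)\,e_n$, where $\det X_n$ is the determinant of a Gram matrix of $X_n$, and let $c_n$ be the number of elements of the orbit $W(X_n)z_n$. Write $(a^pb^q)$ for the set of vectors having $p$ coordinates equal to $a$ and $q$ equal to $b$, in any order. (1) For each of these $X_n$ (with the same $m$, and $X_{n-1}=L_{2,m,n-1}$),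 identifying $\mathbb{Q}^{n-1}$ with the vectors of $\mathbb{Q}^n$ whose last coordinate is $0$, there is an injective homomorphism $\varphi\colon W(X_{n-1})\to W(X_n)$ with $\varphi(s_a)=s_a$ for every root $a$ of $X_{n-1}$, such that $\varphi(w)$ extends $w$ for every $w\in W(X_{n-1})$, and whose image is the isotropy group of $z_n$ in $W(X_n)$. The group $W(X_n)$ is finite, and $|W(X_n)|=c_n\,|W(X_{n-1})|$. (2) For $A_n$ ($n\ge 1$): $c_n=n+1$ and $|W(A_n)|=(n+1)!$. (3) For $D_n$ ($n\ge 2$): $c_n=2n$ and $|W(D_n)|=2^{n-1}\,n!$. (4) $|W(E_3)|=12$. For $E_6$: $W(E_6)z_6=(1^5\,4^1)\cup((-2)^2\,1^4)\cup((-2)^5\,1^1)$, $c_6=27$, and $|W(E_6)|=27\,|W(D_5)|=51840$. For $E_7$: $W(E_7)z_7=(1^6\,3^1)\cup((-1)^2\,1^5)\cup((-1)^5\,1^2)\cup((-3)^1\,(-1)^6)$, $c_7=56$, and $|W(E_7)|=56\,|W(E_6)|=2903040$. For $E_8$: $W(E_8)z_8$ is the set of all roots of $E_8$, $c_8=240$,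 and $|W(E_8)|=240\,|W(E_7)|=696729600$. -/

import Mathlib

namespace CheckerboardLattice

/-- The latitude of an integer vector: the sum of its entries, as a linear form on `ℤⁿ`. -/
def latitude (n : ℕ) : (Fin n → ℤ) →ₗ[ℤ] ℤ :=
  ∑ i, LinearMap.proj i

/-- The underlying group of `L_{k,m,n}` (it does not depend on `k`): the integer vectors whose
latitude is divisible by `m`. -/
def lattice (m : ℤ) (n : ℕ) : Submodule ℤ (Fin n → ℤ) :=
  (Submodule.span ℤ {m}).comap (latitude n)

/-- The matrix `B_{k,m,n} = I + ((k - m) / m²) J`. -/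
def formMatrix (k m : ℤ) (n : ℕ) : Matrix (Fin n) (Fin n) ℚ :=
  1 + (((k : ℚ) - m) / (m : ℚ) ^ 2) • Matrix.of fun _ _ => 1

/-- The symmetric bilinear form `(x|y)_{k,m,n}` on `ℚⁿ`. -/
noncomputable def form (k m : ℤ) (n : ℕ) : LinearMap.BilinForm ℚ (Fin n → ℚ) :=
  Matrix.toBilin' (formMatrix k m n)

/-- The inclusion `ℤⁿ ⊂ ℚⁿ`. -/
def toRat {n : ℕ} (x : Fin n → ℤ) : Fin n → ℚ := fun i => (x i : ℚ)

/-- The determinant of the lattice `L_{k,m,n}`: the determinant of the Gram matrix of a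
`ℤ`-basis (its value does not depend on the basis). -/
noncomputable def latticeDet (k m : ℤ) (n : ℕ) : ℚ :=
  (Matrix.of fun i j : Module.Free.ChooseBasisIndex ℤ (lattice m n) =>
    form k m n (toRat (Module.Free.chooseBasis ℤ (lattice m n) i : Fin n → ℤ))
      (toRat (Module.Free.chooseBasis ℤ (lattice m n) j : Fin n → ℤ))).det

/-- The roots of `L_{k,m,n}`: its elements of squared norm `2`. -/
def roots (k m : ℤ) (n : ℕ) : Set (Fin n → ℤ) :=
  {a | a ∈ lattice m n ∧ form k m n (toRat a) (toRat a) = 2}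

/-- The reflection `x ↦ x - (a|x) a` of `ℚⁿ` with respect to a root `a`. -/
noncomputable def rootReflection {k m : ℤ} {n : ℕ} (a : roots k m n) :
    (Fin n → ℚ) ≃ₗ[ℚ] (Fin n → ℚ) :=
  Module.reflection (x := toRat (a : Fin n → ℤ))
    (f := form k m n (toRat (a : Fin n → ℤ))) a.2.2

/-- The Weyl group of `L_{k,m,n}`: the group generated by the reflections in its roots. -/
noncomputable def weylGroup (k m : ℤ) (n : ℕ) : Subgroup ((Fin n → ℚ) ≃ₗ[ℚ] (Fin n → ℚ)) :=
  Subgroup.closure (Set.range (rootReflection (k := k) (m := m) (n := n)))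

/-- The reflection in a root as an element of the Weyl group. -/
noncomputable def weylReflection {k m : ℤ} {n : ℕ} (a : roots k m n) : weylGroup k m n :=
  ⟨rootReflection a, Subgroup.subset_closure ⟨a, rfl⟩⟩

/-- The inclusion `ℤⁿ ⊂ ℤⁿ⁺¹` or `ℚⁿ ⊂ ℚⁿ⁺¹` as the vectors with last coordinate `0`. -/
def appendZero {R : Type*} [Zero R] {n : ℕ} (x : Fin n → R) : Fin (n + 1) → R :=
  Fin.snoc (α := fun _ => R) x 0

theorem latitude_appendZero {n : ℕ} (a : Fin n → ℤ) :
    latitude (n + 1) (appendZero a) = latitude n a := by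
  simp [latitude, appendZero, Fin.sum_univ_castSucc]

theorem form_apply (k m : ℤ) (n : ℕ) (x y : Fin n → ℚ) :
    form k m n x y =
      ∑ i, x i * y i + (∑ i, x i) * (∑ i, y i) / (m : ℚ) ^ 2 * ((k : ℚ) - m) := by
  have h : Matrix.mulVec (Matrix.of fun _ _ : Fin n => (1 : ℚ)) y = fun _ => ∑ i, y i := by
    ext i
    simp [Matrix.mulVec, dotProduct]
  rw [form, Matrix.toBilin'_apply', formMatrix, Matrix.add_mulVec, Matrix.one_mulVec,
    Matrix.smul_mulVec, h]
  simp only [dotProduct, Pi.add_apply, Pi.smul_apply, smul_eq_mul, mul_add,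
    Finset.sum_add_distrib, ← Finset.sum_mul]
  ring

theorem form_appendZero (k m : ℤ) {n : ℕ} (a b : Fin n → ℤ) :
    form k m (n + 1) (toRat (appendZero a)) (toRat (appendZero b)) =
      form k m n (toRat a) (toRat b) := by
  simp [form_apply, toRat, appendZero, Fin.sum_univ_castSucc]

/-- A root of `L_{k,m,n}` seen as a root of `L_{k,m,n+1}`. -/
def extendRoot {k m : ℤ} {n : ℕ} (a : roots k m n) : roots k m (n + 1) :=
  ⟨appendZero (a : Fin n → ℤ), by
    refine ⟨?_, ?_⟩
    · have h := a.2.1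
      simp only [lattice, Submodule.mem_comap] at h ⊢
      rwa [latitude_appendZero]
    · rw [form_appendZero]
      exact a.2.2⟩

/-- The element `z_j = (m - k)(e_1 + ⋯ + e_n) + (det L) e_j` of `L = L_{k,m,n}`, in `ℚⁿ`. -/
noncomputable def zVec (k m : ℤ) (n : ℕ) (j : Fin n) : Fin n → ℚ :=
  ((m : ℚ) - k) • (fun _ => 1) + latticeDet k m n • Pi.single j 1

/-- The orbit of `z_n` under the Weyl group of `X_n = L_{2,m,n}`, with `n + 1` in place of
`n ≥ 1`. -/
noncomputable def zOrbit (m : ℤ) (n : ℕ) : Set (Fin (n + 1) → ℚ) :=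
  MulAction.orbit (weylGroup 2 m (n + 1)) (zVec 2 m (n + 1) (Fin.last n))

/-- The pairs `(m, n)` for which `L_{2,m,n}` is one of `A_n` (`n ≥ 1`), `D_n` (`n ≥ 2`),
`E_n` (`3 ≤ n ≤ 8`). -/
def IsADE (m : ℤ) (n : ℕ) : Prop :=
  (m = 1 ∧ 1 ≤ n) ∨ (m = 2 ∧ 2 ≤ n) ∨ (m = 3 ∧ 3 ≤ n ∧ n ≤ 8)

/-- The multiset of the coordinates of a vector. -/
def shape {n : ℕ} (x : Fin n → ℚ) : Multiset ℚ :=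
  (Finset.univ : Finset (Fin n)).val.map x

/-- The shape `(a^p b^q)`: the entry `a` with multiplicity `p` and `b` with multiplicity `q`. -/
def shapeOf (a : ℚ) (p : ℕ) (b : ℚ) (q : ℕ) : Multiset ℚ :=
  Multiset.replicate p a + Multiset.replicate q b

end CheckerboardLattice

/-!
The statement rests on the orbit-stabilizer theorem: once the isotropy group of `z_n` in `W(X_n)` is
known to be `W(X_{n-1})` and the orbit of `z_n` is known explicitly, the orders follow by induction
on `n`.

*Isotropy group.* In a finite reflection group the isotropy group of any vector is generated by the
reflections that fix it (`RootFamily.mem_closure_of_fixes`). To see this, order the roots so that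
the vector is dominant, call a positive root simple if its reflection permutes the other positive
roots, and use the exchange condition (`RootFamily.exists_word_eq_mul_refl`) to strip letters off a
word in simple reflections that fixes the vector. Since `(x|z_n) = det X_n · x_n` (`form_zVec`, with
the determinant from `latticeDet_succ`), the roots orthogonal to `z_n` are those of `X_{n-1}`, and
since `z_n` spans a complement of `ℚⁿ⁻¹`, extending an automorphism by fixing `z_n` gives `φ`
(`weylExtend`, `range_weylExtend`).

*Orbit.* Write a vector as `(m - 2)(e_1 + ⋯ + e_n) + det X_n · y`. In terms of `y` the Weyl group
preserves the set of integer vectors with `∑ y_i = 1 + m s` and `∑ y_i² = 1 + (m - 2) s²` for some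
`s` (`exceptional`), and `z_n` corresponds to `e_n`. The orbit is the whole set (`zOrbit_eq`). For
`m = 1, 2` the set is `{e_i} ∪ {0}`, respectively `{± e_i}`. For `m = 3` it consists of the classes
of the exceptional curves on a del Pezzo surface, and transitivity is Noether's argument: the three
largest multiplicities of a curve of positive degree add up to more than the degree
(`exists_three_sum_lt`), so that the reflection in a root `e_i + e_j + e_k` lowers the degree. For
`n ≤ 7` these classes, and for `n = 8` the roots into which a translation turns them, have bounded
entries and are counted by a verified recursion (`countVectors`). The shapes for `E_6` and `E_7` are
determined by their sums and sums of squares (`map_eq_replicate_iff`).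
-/

namespace CheckerboardLattice

/-! ### Isotropy groups in finite reflection groups -/

/-- A simply laced root family in a rational vector space `V` with a symmetric bilinear form `B`:
vectors of squared norm `2`, closed under their own reflections, such that two distinct ones with
positive product have product `1`. Repetitions are allowed. -/
structure RootFamily {V : Type*} [AddCommGroup V] [Module ℚ V] (B : LinearMap.BilinForm ℚ V)
    (ι : Type*) where
  root : ι → V
  symm : ∀ x y, B x y = B y x
  norm : ∀ i, B (root i) (root i) = 2
  closed : ∀ i j, ∃ k, root k = root j - B (root i) (root j) • root i
  pairing : ∀ i j, root i ≠ root j → 0 < B (root i) (root j) → B (root i) (root j) = 1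

namespace RootFamily

variable {V Γ ι : Type*} [AddCommGroup V] [Module ℚ V] {B : LinearMap.BilinForm ℚ V}
  (R : RootFamily B ι)

/-- The reflection `x ↦ x - B(a, x) a` in the root `a`. -/
noncomputable def refl (i : ι) : V ≃ₗ[ℚ] V :=
  Module.reflection (x := R.root i) (f := B (R.root i)) (R.norm i)

theorem refl_apply (i : ι) (x : V) : R.refl i x = x - B (R.root i) x • R.root i :=
  Module.reflection_apply _ _

theorem refl_mul_self (i : ι) : R.refl i * R.refl i = 1 := by
  ext x
  exact Module.involutive_reflection (R.norm i) x

theorem refl_inv (i : ι) : (R.refl i)⁻¹ = R.refl i :=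
  inv_eq_of_mul_eq_one_left (R.refl_mul_self i)

theorem refl_root_self (i : ι) : R.refl i (R.root i) = -R.root i := by
  rw [refl_apply, R.norm, two_smul]
  abel

theorem refl_eq_of_root_eq {i j : ι} (h : R.root i = R.root j) : R.refl i = R.refl j := by
  ext x
  rw [refl_apply, refl_apply, h]

theorem refl_eq_of_root_eq_neg {i j : ι} (h : R.root i = -R.root j) : R.refl i = R.refl j := by
  ext x
  simp [refl_apply, h]

theorem form_refl_refl (i : ι) (x y : V) : B (R.refl i x) (R.refl i y) = B x y := by
  have := R.symm x (R.root i)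
  simp only [refl_apply, map_sub, LinearMap.sub_apply, map_smul, LinearMap.smul_apply,
    smul_eq_mul, R.norm, this]
  ring

theorem exists_neg (i : ι) : ∃ j, R.root j = -R.root i := by
  obtain ⟨k, hk⟩ := R.closed i i
  exact ⟨k, by rw [hk, ← refl_apply, refl_root_self]⟩

/-- The product of the reflections in a list of roots. -/
noncomputable def word (l : List ι) : V ≃ₗ[ℚ] V := (l.map R.refl).prod

@[simp] theorem word_nil : R.word [] = 1 := rfl

@[simp] theorem word_cons (i : ι) (l : List ι) : R.word (i :: l) = R.refl i * R.word l := by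
  simp [word]

@[simp] theorem word_append (l l' : List ι) : R.word (l ++ l') = R.word l * R.word l' := by
  simp [word]

theorem form_word_word (l : List ι) (x y : V) : B (R.word l x) (R.word l y) = B x y := by
  induction l with
  | nil => rfl
  | cons i l ih => rw [word_cons, LinearEquiv.mul_apply, LinearEquiv.mul_apply, form_refl_refl, ih]

theorem exists_root_eq_word (l : List ι) (i : ι) : ∃ j, R.root j = R.word l (R.root i) := by
  induction l with
  | nil => exact ⟨i, rfl⟩
  | cons j l ih =>
    obtain ⟨k, hk⟩ := ih
    obtain ⟨k', hk'⟩ := R.closed j k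
    exact ⟨k', by rw [word_cons, LinearEquiv.mul_apply, ← hk, refl_apply, hk']⟩

/-- A word conjugates the reflection in a root to the reflection in the image of that root. -/
theorem refl_mul_word_of_root_eq {l : List ι} {i j : ι} (h : R.root j = R.word l (R.root i)) :
    R.refl j * R.word l = R.word l * R.refl i := by
  ext x
  simp only [LinearEquiv.mul_apply, refl_apply, h, map_sub, map_smul, form_word_word]

variable [AddCommGroup Γ] [LinearOrder Γ] (h : V →+ Γ)

/-- A root is positive if its height `h` is, and a positive root is simple if its reflection keeps
every other positive root positive. -/
def IsSimple (i : ι) : Prop :=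
  0 < h (R.root i) ∧
    ∀ j, 0 < h (R.root j) → R.root j ≠ R.root i → 0 < h (R.refl i (R.root j))

/-- A positive root that is not simple is a sum `b + c` of two lower positive roots, and its
reflection is then the product `s_b s_c s_b`. -/
theorem refl_mem_closure_simple [IsOrderedAddMonoid Γ] [Finite ι]
    (h0 : ∀ i, h (R.root i) ≠ 0) (i : ι) :
    R.refl i ∈ Subgroup.closure (R.refl '' {i | R.IsSimple h i}) := by
  suffices H : ∀ i, 0 < h (R.root i) →
      R.refl i ∈ Subgroup.closure (R.refl '' {i | R.IsSimple h i}) by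
    rcases lt_or_gt_of_ne (h0 i) with hi | hi
    · obtain ⟨j, hj⟩ := R.exists_neg i
      rw [← R.refl_eq_of_root_eq_neg hj]
      exact H j (by rw [hj, map_neg]; exact neg_pos.2 hi)
    · exact H i hi
  have : IsTrans ι fun i j => h (R.root i) < h (R.root j) := ⟨fun _ _ _ => lt_trans⟩
  have : Std.Irrefl fun i j : ι => h (R.root i) < h (R.root j) := ⟨fun _ => lt_irrefl _⟩
  intro i
  induction i using (Finite.wellFounded_of_trans_of_irrefl
    fun i j : ι => h (R.root i) < h (R.root j)).induction with
  | _ i ih =>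
  intro hi
  by_cases hs : R.IsSimple h i
  · exact Subgroup.subset_closure ⟨i, hs, rfl⟩
  obtain ⟨j, hj, hne, hle⟩ : ∃ j, 0 < h (R.root j) ∧ R.root j ≠ R.root i ∧
      h (R.refl i (R.root j)) ≤ 0 := by
    by_contra! H
    exact hs ⟨hi, H⟩
  obtain ⟨k, hk⟩ := R.closed i j
  rw [refl_apply] at hle
  have hpos : 0 < B (R.root i) (R.root j) := by
    by_contra! hB
    refine hle.not_gt ?_
    rw [sub_eq_add_neg, ← neg_smul, map_add]
    refine add_pos_of_pos_of_nonneg hj ?_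
    -- `h` is only additive, so that a nonnegative rational multiple is handled by its denominator
    set q : ℚ := -B (R.root i) (R.root j) with hq
    have hq0 : 0 ≤ q := by linarith
    have hden : q.den • h (q • R.root i) = q.num.toNat • h (R.root i) := by
      rw [← map_nsmul, ← map_nsmul]
      congr 1
      rw [← Nat.cast_smul_eq_nsmul ℚ, ← Nat.cast_smul_eq_nsmul ℚ, smul_smul]
      congr 1
      have : ((q.num.toNat : ℤ) : ℚ) = q.num := by
        rw [Int.toNat_of_nonneg (Rat.num_nonneg.2 hq0)]
      rw [mul_comm, Rat.mul_den_eq_num, ← this, Int.cast_natCast]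
    by_contra! hneg
    have h1 : q.den • h (q • R.root i) < 0 := nsmul_neg hneg q.den_nz
    rw [hden] at h1
    exact h1.not_ge (nsmul_nonneg hi.le _)
  have hB : B (R.root i) (R.root j) = 1 := R.pairing i j hne.symm hpos
  rw [hB, one_smul] at hle hk
  obtain ⟨c, hc⟩ := R.exists_neg k
  have hc' : R.root c = R.root i - R.root j := by rw [hc, hk]; abel
  have hcpos : 0 < h (R.root c) := by
    refine lt_of_le_of_ne ?_ (h0 c).symm
    rw [hc', ← neg_sub, map_neg]
    exact neg_nonneg.2 hle
  have hsum : h (R.root i) = h (R.root j) + h (R.root c) := by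
    rw [← map_add, hc']
    congr 1
    abel
  have hi_eq : R.root i = R.word [j] (R.root c) := by
    have h1 : B (R.root j) (R.root c) = -1 := by
      rw [hc', map_sub, R.norm, R.symm, hB]
      norm_num
    rw [word_cons, word_nil, mul_one, refl_apply, h1, hc']
    simp
  have hconj := R.refl_mul_word_of_root_eq hi_eq
  rw [word_cons, word_nil, mul_one, ← eq_mul_inv_iff_mul_eq, refl_inv] at hconj
  have hjm := ih j (by rw [hsum]; exact lt_add_of_pos_right _ hcpos) hj
  have hcm := ih c (by rw [hsum]; exact lt_add_of_pos_left _ hj) hcpos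
  rw [hconj]
  exact mul_mem (mul_mem hjm hcm) hjm

theorem exists_simple_word [IsOrderedAddMonoid Γ] [Finite ι]
    (h0 : ∀ i, h (R.root i) ≠ 0) {w : V ≃ₗ[ℚ] V}
    (hw : w ∈ Subgroup.closure (Set.range R.refl)) :
    ∃ l : List ι, (∀ i ∈ l, R.IsSimple h i) ∧ w = R.word l := by
  have hw' : w ∈ Subgroup.closure (R.refl '' {i | R.IsSimple h i}) := by
    refine (Subgroup.closure_le _).2 ?_ hw
    rintro _ ⟨i, rfl⟩
    exact R.refl_mem_closure_simple h h0 i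
  clear hw
  induction hw' using Subgroup.closure_induction'' with
  | one => exact ⟨[], by simp, rfl⟩
  | mem x hx =>
    obtain ⟨i, hi, rfl⟩ := hx
    exact ⟨[i], by simpa using hi, by simp⟩
  | inv_mem x hx =>
    obtain ⟨i, hi, rfl⟩ := hx
    exact ⟨[i], by simpa using hi, by simp [refl_inv]⟩
  | mul x y _ _ hx hy =>
    obtain ⟨l, hl, rfl⟩ := hx
    obtain ⟨l', hl', rfl⟩ := hy
    refine ⟨l ++ l', fun i hi => ?_, by simp⟩
    rcases List.mem_append.1 hi with hi | hi
    · exact hl i hi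
    · exact hl' i hi

/-- The exchange condition: if a word in simple reflections makes the simple root `a` negative,
then it can be rewritten as a word of the same length that ends in `s_a`. -/
theorem exists_word_eq_mul_refl (h0 : ∀ i, h (R.root i) ≠ 0) {i : ι} (hi : R.IsSimple h i)
    (l : List ι) (hl : ∀ j ∈ l, R.IsSimple h j) (hneg : h (R.word l (R.root i)) < 0) :
    ∃ l' : List ι, (∀ j ∈ l', R.IsSimple h j) ∧ l'.length + 1 = l.length ∧
      R.word l = R.word l' * R.refl i := by
  induction l with
  | nil => exact absurd hneg hi.1.not_gt
  | cons b l ih =>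
    have hl' : ∀ j ∈ l, R.IsSimple h j := fun j hj => hl j (List.mem_cons_of_mem _ hj)
    have hb : R.IsSimple h b := hl b List.mem_cons_self
    obtain ⟨c, hc⟩ := R.exists_root_eq_word l i
    rcases lt_or_gt_of_ne (h0 c) with hcn | hcp
    · obtain ⟨l', h1, h2, h3⟩ := ih hl' (hc ▸ hcn)
      refine ⟨b :: l', ?_, by simp [h2], by rw [word_cons, word_cons, h3, mul_assoc]⟩
      intro j hj
      rcases List.mem_cons.1 hj with rfl | hj
      · exact hb
      · exact h1 j hj
    · refine ⟨l, hl', rfl, ?_⟩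
      have hcb : R.root c = R.root b := by
        by_contra hne
        have := hb.2 c hcp hne
        rw [word_cons, LinearEquiv.mul_apply, ← hc] at hneg
        exact this.not_gt hneg
      rw [word_cons]
      exact R.refl_mul_word_of_root_eq (hcb ▸ hc)

/-- The isotropy group of a dominant vector is generated by the reflections that fix it. -/
theorem mem_closure_of_fixes_of_dominant [IsOrderedAddMonoid Γ] [Finite ι]
    (h0 : ∀ i, h (R.root i) ≠ 0) {z : V}
    (hz : ∀ i, 0 < h (R.root i) → 0 ≤ B (R.root i) z) {w : V ≃ₗ[ℚ] V}
    (hw : w ∈ Subgroup.closure (Set.range R.refl)) (hwz : w z = z) :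
    w ∈ Subgroup.closure (R.refl '' {i | B (R.root i) z = 0}) := by
  obtain ⟨l, hl, rfl⟩ := R.exists_simple_word h h0 hw
  clear hw
  induction hn : l.length using Nat.strong_induction_on generalizing l with
  | _ n ih =>
  subst hn
  rcases List.eq_nil_or_concat l with rfl | ⟨l₀, a, rfl⟩
  · exact one_mem _
  rw [List.concat_eq_append] at *
  have hl₀ : ∀ j ∈ l₀, R.IsSimple h j := fun j hj => hl j (by simp [hj])
  have ha : R.IsSimple h a := hl a (by simp)
  obtain ⟨c, hc⟩ := R.exists_root_eq_word l₀ a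
  simp only [word_append, word_cons, word_nil, mul_one] at hwz ⊢
  rcases lt_or_gt_of_ne (h0 c) with hcn | hcp
  · -- the word is not reduced and loses two letters
    obtain ⟨l', h1, h2, h3⟩ := R.exists_word_eq_mul_refl h h0 ha l₀ hl₀ (hc ▸ hcn)
    have h4 : R.word l₀ * R.refl a = R.word l' := by
      rw [h3, mul_assoc, refl_mul_self, mul_one]
    rw [h4] at hwz ⊢
    exact ih _ (by simp; omega) l' h1 hwz rfl
  · -- `w` sends `a` to the negative root `-c`, so that `B(a, z) = B(w a, z)` is
    -- both nonnegative and nonpositive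
    have h1 : B (R.root a) z = 0 := by
      refine le_antisymm ?_ (hz a ha.1)
      have h2 := hz c hcp
      have h3 : B ((R.word l₀) (R.refl a (R.root a))) ((R.word l₀) (R.refl a z)) =
          B (R.root a) z := by
        rw [form_word_word, form_refl_refl]
      rw [LinearEquiv.mul_apply] at hwz
      rw [hwz, refl_root_self, map_neg, ← hc, map_neg, LinearMap.neg_apply] at h3
      linarith
    have h2 : R.refl a z = z := by rw [refl_apply, h1]; simp
    refine mul_mem (ih _ (by simp) l₀ hl₀ ?_ rfl) (Subgroup.subset_closure ⟨a, h1, rfl⟩)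
    rwa [LinearEquiv.mul_apply, h2] at hwz

end RootFamily

/-- The isotropy group of any vector of `ℚⁿ` in a finite simply laced reflection group is generated
by the reflections that fix it. -/
theorem RootFamily.mem_closure_of_fixes {n : ℕ} {ι : Type*} [Finite ι]
    {B : LinearMap.BilinForm ℚ (Fin n → ℚ)} (R : RootFamily B ι) {z : Fin n → ℚ}
    {w : (Fin n → ℚ) ≃ₗ[ℚ] (Fin n → ℚ)}
    (hw : w ∈ Subgroup.closure (Set.range R.refl)) (hwz : w z = z) :
    w ∈ Subgroup.closure (R.refl '' {i | B (R.root i) z = 0}) := by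
  -- `z` is dominant for the lexicographic order that compares the products with `z` first
  let h : (Fin n → ℚ) →+ ℚ ×ₗ Lex (Fin n → ℚ) :=
    { toFun := fun x => toLex (B z x, toLex x)
      map_zero' := by rw [map_zero]; rfl
      map_add' := fun x y => by rw [map_add]; rfl }
  refine R.mem_closure_of_fixes_of_dominant h ?_ ?_ hw hwz
  · intro i hi
    have h1 : R.root i = 0 := congrArg (fun p => ofLex (ofLex p).2) hi
    have h2 := R.norm i
    rw [h1, map_zero] at h2
    norm_num at h2
  · intro i hi
    rw [R.symm]
    rcases Prod.Lex.lt_iff.1 hi with h1 | h1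
    · exact le_of_lt h1
    · exact le_of_eq h1.1

/-! ### The form on the lattice -/

/-- The pairs `(m, n)` for which `L_{2,m,n}` is treated as a positive definite lattice below: beyond
the types `A`, `D`, `E`, they include the small `n` from which the induction on `n` starts. -/
def IsAdmissible (m : ℤ) (n : ℕ) : Prop :=
  m = 1 ∨ m = 2 ∨ (m = 3 ∧ n ≤ 8)

theorem IsAdmissible.ne_zero {m : ℤ} {n : ℕ} (h : IsAdmissible m n) : m ≠ 0 := by
  rcases h with rfl | rfl | ⟨rfl, -⟩ <;> norm_num

theorem IsAdmissible.of_succ {m : ℤ} {n : ℕ} (h : IsAdmissible m (n + 1)) : IsAdmissible m n := by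
  rcases h with h | h | ⟨h, h'⟩
  · exact .inl h
  · exact .inr (.inl h)
  · exact .inr (.inr ⟨h, by omega⟩)

theorem IsADE.isAdmissible {m : ℤ} {n : ℕ} (h : IsADE m n) : IsAdmissible m n := by
  rcases h with ⟨h, -⟩ | ⟨h, -⟩ | ⟨h, -, h'⟩
  · exact .inl h
  · exact .inr (.inl h)
  · exact .inr (.inr ⟨h, h'⟩)

theorem latitude_apply {n : ℕ} (a : Fin n → ℤ) : latitude n a = ∑ i, a i := by
  simp [latitude]

theorem mem_lattice_iff {m : ℤ} {n : ℕ} {a : Fin n → ℤ} :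
    a ∈ lattice m n ↔ ∃ s : ℤ, ∑ i, a i = m * s := by
  simp only [lattice, Submodule.mem_comap, latitude_apply, Submodule.mem_span_singleton,
    smul_eq_mul]
  exact exists_congr fun s => by rw [eq_comm, mul_comm]

theorem toRat_injective {n : ℕ} : Function.Injective (toRat (n := n)) := fun a b h => by
  ext i
  exact Int.cast_injective (congrFun h i)

theorem form_symm (k m : ℤ) (n : ℕ) (x y : Fin n → ℚ) : form k m n x y = form k m n y x := by
  simp only [form_apply, mul_comm]

theorem form_toRat {m : ℤ} (hm : m ≠ 0) {n : ℕ} {a b : Fin n → ℤ} {s t : ℤ}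
    (ha : ∑ i, a i = m * s) (hb : ∑ i, b i = m * t) :
    form 2 m n (toRat a) (toRat b) = ((∑ i, a i * b i + (2 - m) * s * t : ℤ) : ℚ) := by
  have hm' : (m : ℚ) ≠ 0 := by exact_mod_cast hm
  have ha' : ∑ i, (a i : ℚ) = m * s := by exact_mod_cast ha
  have hb' : ∑ i, (b i : ℚ) = m * t := by exact_mod_cast hb
  simp only [form_apply, toRat, ha', hb']
  push_cast
  field_simp

theorem mem_roots_iff {m : ℤ} (hm : m ≠ 0) {n : ℕ} {a : Fin n → ℤ} :
    a ∈ roots 2 m n ↔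
      ∃ t : ℤ, ∑ i, a i = m * t ∧ ∑ i, a i ^ 2 = 2 + (m - 2) * t ^ 2 := by
  constructor
  · rintro ⟨h1, h2⟩
    obtain ⟨t, ht⟩ := mem_lattice_iff.1 h1
    refine ⟨t, ht, ?_⟩
    rw [form_toRat hm ht ht] at h2
    have h3 : ∑ i, a i * a i + (2 - m) * t * t = 2 := by exact_mod_cast h2
    simp only [pow_two]
    linarith
  · rintro ⟨t, ht, h⟩
    refine ⟨mem_lattice_iff.2 ⟨t, ht⟩, ?_⟩
    rw [form_toRat hm ht ht]
    simp only [pow_two] at h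
    rw [h]
    push_cast
    ring

/-- The form of an admissible lattice is positive definite, with a bound independent of `n`. -/
theorem sum_sq_le_form {m : ℤ} {n : ℕ} (h : IsAdmissible m n) (x : Fin n → ℚ) :
    ∑ i, x i ^ 2 ≤ 9 * form 2 m n x x := by
  have hcs : (∑ i, x i) ^ 2 ≤ n * ∑ i, x i ^ 2 := by
    simpa using sq_sum_le_card_mul_sum_sq (s := Finset.univ) (f := x)
  have h0 : 0 ≤ ∑ i, x i ^ 2 := Finset.sum_nonneg fun i _ => sq_nonneg _
  have h1 : 0 ≤ (∑ i, x i) ^ 2 := sq_nonneg _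
  simp only [form_apply, ← pow_two]
  rcases h with rfl | rfl | ⟨rfl, hn⟩
  · norm_num
    linarith
  · norm_num
    linarith
  · have hn' : (n : ℚ) ≤ 8 := by exact_mod_cast hn
    have : n * ∑ i, x i ^ 2 ≤ 8 * ∑ i, x i ^ 2 := mul_le_mul_of_nonneg_right hn' h0
    norm_num
    linarith

theorem finite_setOf_sum_sq_le (n : ℕ) (c : ℤ) : {a : Fin n → ℤ | ∑ i, a i ^ 2 ≤ c}.Finite := by
  refine (Set.finite_Icc (fun _ : Fin n => -c) (fun _ => c)).subset ?_
  intro a ha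
  have h1 : ∀ i, a i ^ 2 ≤ c := fun i =>
    (Finset.single_le_sum (f := fun i => a i ^ 2) (fun i _ => sq_nonneg _)
      (Finset.mem_univ i)).trans ha
  constructor
  · intro i
    have := h1 i
    change -c ≤ a i
    nlinarith [Int.le_self_sq (-a i)]
  · intro i
    exact (Int.le_self_sq (a i)).trans (h1 i)

theorem finite_roots {m : ℤ} {n : ℕ} (h : IsAdmissible m n) : Finite (roots 2 m n) := by
  refine (finite_setOf_sum_sq_le n 18).subset fun a ha => ?_
  have h1 := sum_sq_le_form h (toRat a)
  rw [ha.2] at h1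
  have h2 : ((∑ i, a i ^ 2 : ℤ) : ℚ) ≤ (18 : ℤ) := by
    push_cast
    refine h1.trans ?_
    norm_num
  exact_mod_cast h2

/-- The roots of an admissible lattice as a simply laced root family. -/
noncomputable def rootFamily {m : ℤ} {n : ℕ} (h : IsAdmissible m n) :
    RootFamily (form 2 m n) (roots 2 m n) where
  root a := toRat (a : Fin n → ℤ)
  symm := form_symm 2 m n
  norm a := a.2.2
  closed a b := by
    obtain ⟨s, hs⟩ := mem_lattice_iff.1 a.2.1
    obtain ⟨t, ht⟩ := mem_lattice_iff.1 b.2.1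
    have hab := form_toRat h.ne_zero hs ht
    set q : ℤ := ∑ i, a.1 i * b.1 i + (2 - m) * s * t
    have heq : toRat (b.1 - q • a.1) =
        toRat b.1 - form 2 m n (toRat a.1) (toRat b.1) • toRat a.1 := by
      rw [hab]
      ext i
      simp [toRat]
    refine ⟨⟨b.1 - q • a.1, sub_mem b.2.1 ((lattice m n).smul_mem q a.2.1), ?_⟩, heq⟩
    have hb := b.2.2
    have ha := a.2.2
    have hsym := form_symm 2 m n (toRat b.1) (toRat a.1)
    rw [heq]
    simp only [map_sub, LinearMap.sub_apply, map_smul, LinearMap.smul_apply, smul_eq_mul]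
    rw [hb, ha, hsym]
    ring
  pairing a b hne hpos := by
    obtain ⟨s, hs⟩ := mem_lattice_iff.1 a.2.1
    obtain ⟨t, ht⟩ := mem_lattice_iff.1 b.2.1
    have hab := form_toRat h.ne_zero hs ht
    have hb := b.2.2
    have ha := a.2.2
    have hsym := form_symm 2 m n (toRat b.1) (toRat a.1)
    have h1 := sum_sq_le_form h (toRat a.1 - toRat b.1)
    simp only [map_sub, LinearMap.sub_apply] at h1
    rw [ha, hb, hsym] at h1
    have h2 : 0 < ∑ i, (toRat a.1 - toRat b.1) i ^ 2 := by
      obtain ⟨i, hi⟩ := Function.ne_iff.1 hne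
      refine Finset.sum_pos' (fun i _ => sq_nonneg _) ⟨i, Finset.mem_univ i, ?_⟩
      have : (toRat a.1 - toRat b.1) i ≠ 0 := sub_ne_zero.2 hi
      positivity
    have h3 : form 2 m n (toRat a.1) (toRat b.1) < 2 := by linarith
    rw [hab] at h3 hpos ⊢
    have h4 : ∑ i, a.1 i * b.1 i + (2 - m) * s * t < 2 := by exact_mod_cast h3
    have h5 : 0 < ∑ i, a.1 i * b.1 i + (2 - m) * s * t := by exact_mod_cast hpos
    have h6 : ∑ i, a.1 i * b.1 i + (2 - m) * s * t = 1 := by omega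
    exact_mod_cast h6

theorem rootReflection_apply {m : ℤ} {n : ℕ} (a : roots 2 m n) (x : Fin n → ℚ) :
    rootReflection a x = x - form 2 m n (toRat a.1) x • toRat a.1 :=
  Module.reflection_apply _ _

/-! ### The determinant of the lattice -/

/-- The coordinates of a basis of the lattice `L_{k,m,n+1}`: the vectors `e_i - e_{n+1}` for `i ≤ n`
and `m e_{n+1}`, as the rows of a triangular matrix. -/
def basisMatrix (m : ℤ) (n : ℕ) : Matrix (Fin (n + 1)) (Fin (n + 1)) ℤ :=
  Matrix.of fun i j => if j = Fin.last n then (if i = Fin.last n then m else -1)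
    else if i = j then 1 else 0

theorem det_basisMatrix (m : ℤ) (n : ℕ) : (basisMatrix m n).det = m := by
  rw [Matrix.det_of_isUpperTriangular]
  · simp [basisMatrix]
  · intro i j hij
    have h1 : j ≠ Fin.last n := ((show j < i from hij).trans_le (Fin.le_last i)).ne
    have h2 : i ≠ j := (show j < i from hij).ne'
    simp [basisMatrix, h1, h2]

theorem vecMul_basisMatrix_castSucc (m : ℤ) {n : ℕ} (c : Fin (n + 1) → ℤ) (j : Fin n) :
    Matrix.vecMul c (basisMatrix m n) j.castSucc = c j.castSucc := by
  simp [Matrix.vecMul, dotProduct, basisMatrix, Fin.castSucc_ne_last]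

theorem vecMul_basisMatrix_last (m : ℤ) {n : ℕ} (c : Fin (n + 1) → ℤ) :
    Matrix.vecMul c (basisMatrix m n) (Fin.last n) =
      m * c (Fin.last n) - ∑ j : Fin n, c j.castSucc := by
  simp [Matrix.vecMul, dotProduct, basisMatrix, Fin.sum_univ_castSucc, Fin.castSucc_ne_last]
  ring

theorem exists_basis_lattice {m : ℤ} (hm : m ≠ 0) (n : ℕ) :
    ∃ b : Module.Basis (Fin (n + 1)) ℤ (lattice m (n + 1)),
      ∀ i, (b i : Fin (n + 1) → ℤ) = basisMatrix m n i := by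
  let T : (Fin (n + 1) → ℤ) →ₗ[ℤ] lattice m (n + 1) :=
    (Matrix.vecMulLinear (basisMatrix m n)).codRestrict (lattice m (n + 1)) fun c => by
      refine mem_lattice_iff.2 ⟨c (Fin.last n), ?_⟩
      simp only [Matrix.vecMulLinear_apply, Fin.sum_univ_castSucc, vecMul_basisMatrix_castSucc,
        vecMul_basisMatrix_last]
      ring
  have hT : ∀ c, (T c : Fin (n + 1) → ℤ) = Matrix.vecMul c (basisMatrix m n) := fun c => rfl
  have hbij : Function.Bijective T := by
    constructor
    · intro c d hcd
      have h1 : Matrix.vecMul c (basisMatrix m n) = Matrix.vecMul d (basisMatrix m n) := by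
        rw [← hT, ← hT, hcd]
      have h2 : ∀ j : Fin n, c j.castSucc = d j.castSucc := fun j => by
        simpa only [vecMul_basisMatrix_castSucc] using congrFun h1 j.castSucc
      have h3 := congrFun h1 (Fin.last n)
      simp only [vecMul_basisMatrix_last, h2] at h3
      ext i
      refine Fin.lastCases ?_ h2 i
      exact mul_left_cancel₀ hm (by linarith)
    · intro x
      obtain ⟨t, ht⟩ := mem_lattice_iff.1 x.2
      refine ⟨Fin.snoc (α := fun _ => ℤ) (Fin.init (α := fun _ => ℤ) x.1) t, ?_⟩
      ext i
      rw [hT]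
      refine Fin.lastCases ?_ (fun j => ?_) i
      · rw [Fin.sum_univ_castSucc] at ht
        simp only [vecMul_basisMatrix_last, Fin.snoc_last, Fin.snoc_castSucc, Fin.init]
        linarith
      · simp [vecMul_basisMatrix_castSucc, Fin.init]
  refine ⟨.ofEquivFun (LinearEquiv.ofBijective T hbij).symm, fun i => ?_⟩
  rw [Module.Basis.coe_ofEquivFun]
  simp only [LinearEquiv.symm_symm, LinearEquiv.ofBijective_apply, hT, Matrix.single_one_vecMul]
  rfl

theorem det_formMatrix (k m : ℤ) (n : ℕ) :
    (formMatrix k m n).det = 1 + n * (((k : ℚ) - m) / (m : ℚ) ^ 2) := by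
  have h : (((k : ℚ) - m) / (m : ℚ) ^ 2) • (Matrix.of fun _ _ : Fin n => (1 : ℚ)) =
      Matrix.replicateCol Unit (fun _ : Fin n => ((k : ℚ) - m) / (m : ℚ) ^ 2) *
        Matrix.replicateRow Unit (fun _ : Fin n => (1 : ℚ)) := by
    ext i j
    simp [Matrix.mul_apply]
  rw [formMatrix, h, Matrix.det_one_add_replicateCol_mul_replicateRow]
  simp [dotProduct]

/-- The Gram determinant is the squared index `m²` of the lattice in `ℤⁿ⁺¹` times the determinant of
`I + ((k - m) / m²) J`. -/
theorem det_gram (k : ℤ) {m : ℤ} (hm : m ≠ 0) (n : ℕ) {ι : Type*} [Fintype ι] [DecidableEq ι]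
    (β : Module.Basis ι ℤ (lattice m (n + 1))) :
    (Matrix.of fun i j => form k m (n + 1) (toRat (β i : Fin (n + 1) → ℤ))
      (toRat (β j : Fin (n + 1) → ℤ))).det = (m : ℚ) ^ 2 + (n + 1) * ((k : ℚ) - m) := by
  obtain ⟨b, hb⟩ := exists_basis_lattice hm n
  let e := β.indexEquiv b
  -- the coordinates of the chosen basis are an invertible matrix times those of the explicit one
  let P : Matrix (Fin (n + 1)) (Fin (n + 1)) ℤ := (b.toMatrix (β.reindex e)).transpose
  let M : Matrix (Fin (n + 1)) (Fin (n + 1)) ℤ := P * basisMatrix m n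
  have hM : ∀ i, M i = (β (e.symm i) : Fin (n + 1) → ℤ) := by
    intro i
    have h1 := b.sum_toMatrix_smul_self (β.reindex e) i
    rw [Module.Basis.reindex_apply] at h1
    ext j
    have h2 := congrFun (congrArg Subtype.val h1) j
    simp only [Submodule.coe_sum, Submodule.coe_smul, Finset.sum_apply, Pi.smul_apply, hb] at h2
    exact h2
  have hP : P.det ^ 2 = 1 := by
    have h1 : IsUnit P.det := by
      rw [Matrix.det_transpose]
      exact b.isUnit_det (β.reindex e)
    rcases Int.isUnit_iff.1 h1 with h | h <;> rw [h] <;> norm_num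
  have hMdet : ((M.map (Int.cast : ℤ → ℚ)).det) ^ 2 = (m : ℚ) ^ 2 := by
    have h1 : (M.map (Int.cast : ℤ → ℚ)).det = (M.det : ℚ) :=
      ((Int.castRingHom ℚ).map_det M).symm
    rw [h1, Matrix.det_mul, det_basisMatrix]
    have h2 : ((P.det : ℚ)) ^ 2 = 1 := by exact_mod_cast hP
    rw [Int.cast_mul, mul_pow, h2, one_mul]
  have hgram : (Matrix.of fun i j => form k m (n + 1) (toRat (β i : Fin (n + 1) → ℤ))
        (toRat (β j : Fin (n + 1) → ℤ))).submatrix e.symm e.symm =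
      M.map (Int.cast : ℤ → ℚ) * formMatrix k m (n + 1) *
        (M.map (Int.cast : ℤ → ℚ)).transpose := by
    ext i j
    have h1 : ∀ i, toRat (β (e.symm i) : Fin (n + 1) → ℤ) = M.map (Int.cast : ℤ → ℚ) i := by
      intro i
      ext j
      rw [← hM]
      rfl
    rw [Matrix.submatrix_apply, Matrix.of_apply, h1, h1, form, Matrix.toBilin'_apply',
      Matrix.mul_mul_apply, Matrix.transpose_transpose]
  rw [← Matrix.det_submatrix_equiv_self e.symm, hgram, Matrix.det_mul, Matrix.det_mul,
    Matrix.det_transpose, det_formMatrix]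
  have hm' : (m : ℚ) ≠ 0 := by exact_mod_cast hm
  have : (M.map (Int.cast : ℤ → ℚ)).det * (1 + ((n + 1 : ℕ) : ℚ) * (((k : ℚ) - m) / (m : ℚ) ^ 2)) *
      (M.map (Int.cast : ℤ → ℚ)).det =
      ((M.map (Int.cast : ℤ → ℚ)).det) ^ 2 *
        (1 + ((n + 1 : ℕ) : ℚ) * (((k : ℚ) - m) / (m : ℚ) ^ 2)) := by ring
  rw [this, hMdet]
  push_cast
  field_simp

theorem latticeDet_succ (k : ℤ) {m : ℤ} (hm : m ≠ 0) (n : ℕ) :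
    latticeDet k m (n + 1) = (m : ℚ) ^ 2 + (n + 1) * ((k : ℚ) - m) :=
  det_gram k hm n _

theorem latticeDet_pos {m : ℤ} {n : ℕ} (h : IsAdmissible m (n + 1)) :
    0 < latticeDet 2 m (n + 1) := by
  rw [latticeDet_succ 2 h.ne_zero]
  rcases h with rfl | rfl | ⟨rfl, hn⟩
  · norm_num
    positivity
  · norm_num
  · have : (n : ℚ) + 1 ≤ 8 := by exact_mod_cast hn
    norm_num
    linarith

/-! ### The vector `z` and the extension of the smaller Weyl group -/

theorem zVec_last_pos {m : ℤ} {n : ℕ} (h : IsAdmissible m (n + 1)) :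
    0 < zVec 2 m (n + 1) (Fin.last n) (Fin.last n) := by
  have hd := latticeDet_succ 2 h.ne_zero n
  have hz : zVec 2 m (n + 1) (Fin.last n) (Fin.last n) = m - 2 + latticeDet 2 m (n + 1) := by
    simp [zVec]
  rw [hz, hd]
  rcases h with rfl | rfl | ⟨rfl, hn⟩
  · norm_num
    positivity
  · norm_num
  · have : (n : ℚ) + 1 ≤ 8 := by exact_mod_cast hn
    norm_num
    linarith

theorem form_zVec {m : ℤ} (hm : m ≠ 0) {n : ℕ} (x : Fin (n + 1) → ℚ) :
    form 2 m (n + 1) x (zVec 2 m (n + 1) (Fin.last n)) =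
      latticeDet 2 m (n + 1) * x (Fin.last n) := by
  have hm' : (m : ℚ) ≠ 0 := by exact_mod_cast hm
  have h1 : ∑ i, zVec 2 m (n + 1) (Fin.last n) i = (m : ℚ) ^ 2 := by
    simp only [zVec, Pi.add_apply, Pi.smul_apply, smul_eq_mul, Finset.sum_add_distrib,
      ← Finset.mul_sum, Finset.sum_pi_single', latticeDet_succ 2 hm]
    simp
    ring
  have h2 : ∑ i, x i * zVec 2 m (n + 1) (Fin.last n) i =
      ((m : ℚ) - 2) * ∑ i, x i + latticeDet 2 m (n + 1) * x (Fin.last n) := by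
    simp only [zVec, Pi.add_apply, Pi.smul_apply, smul_eq_mul, mul_add, Finset.sum_add_distrib,
      Finset.mul_sum]
    congr 1
    · exact Finset.sum_congr rfl fun i _ => by push_cast; ring
    · simp [Pi.single_apply]
      ring
  rw [form_apply, h1, h2]
  push_cast
  field_simp
  ring

theorem form_appendZero_rat (k m : ℤ) {n : ℕ} (x y : Fin n → ℚ) :
    form k m (n + 1) (appendZero x) (appendZero y) = form k m n x y := by
  simp [form_apply, appendZero, Fin.sum_univ_castSucc]

/-- A vector `z` with nonzero last coordinate spans a complement of `ℚⁿ` in `ℚⁿ⁺¹`. -/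
noncomputable def splitEquiv {n : ℕ} (z : Fin (n + 1) → ℚ) (hz : z (Fin.last n) ≠ 0) :
    ((Fin n → ℚ) × ℚ) ≃ₗ[ℚ] (Fin (n + 1) → ℚ) where
  toFun p := appendZero p.1 + p.2 • z
  map_add' p q := by
    ext i
    refine Fin.lastCases ?_ (fun j => ?_) i <;> simp [appendZero] <;> ring
  map_smul' c p := by
    ext i
    refine Fin.lastCases ?_ (fun j => ?_) i <;> simp [appendZero] <;> ring
  invFun x := (fun j => x j.castSucc - x (Fin.last n) / z (Fin.last n) * z j.castSucc,
    x (Fin.last n) / z (Fin.last n))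
  left_inv p := by
    ext <;> simp [appendZero, hz]
  right_inv x := by
    ext i
    refine Fin.lastCases ?_ (fun j => ?_) i <;> simp [appendZero, hz]

/-- The extension of the automorphisms of `ℚⁿ` to `ℚⁿ⁺¹` that fixes `z`. -/
noncomputable def extendHom {n : ℕ} (z : Fin (n + 1) → ℚ) (hz : z (Fin.last n) ≠ 0) :
    ((Fin n → ℚ) ≃ₗ[ℚ] (Fin n → ℚ)) →* ((Fin (n + 1) → ℚ) ≃ₗ[ℚ] (Fin (n + 1) → ℚ)) where
  toFun w := (splitEquiv z hz).symm ≪≫ₗ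
    (w.prodCongr (LinearEquiv.refl ℚ ℚ)) ≪≫ₗ splitEquiv z hz
  map_one' := by
    ext1 x
    simp
  map_mul' v w := by
    ext1 x
    simp

section extendHom

variable {n : ℕ} {z : Fin (n + 1) → ℚ} (hz : z (Fin.last n) ≠ 0)

theorem extendHom_splitEquiv (w : (Fin n → ℚ) ≃ₗ[ℚ] (Fin n → ℚ)) (x : Fin n → ℚ) (c : ℚ) :
    extendHom z hz w (appendZero x + c • z) = appendZero (w x) + c • z := by
  have h : appendZero x + c • z = splitEquiv z hz (x, c) := rfl
  rw [h]
  simp [extendHom]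
  rfl

theorem extendHom_appendZero (w : (Fin n → ℚ) ≃ₗ[ℚ] (Fin n → ℚ)) (x : Fin n → ℚ) :
    extendHom z hz w (appendZero x) = appendZero (w x) := by
  simpa using extendHom_splitEquiv hz w x 0

theorem appendZero_injective : Function.Injective (appendZero (R := ℚ) (n := n)) := fun x y h => by
  ext i
  simpa [appendZero] using congrFun h i.castSucc

theorem extendHom_injective : Function.Injective (extendHom z hz) := fun v w h => by
  ext1 x
  apply appendZero_injective
  rw [← extendHom_appendZero hz, h, extendHom_appendZero]

end extendHom

theorem toRat_appendZero {n : ℕ} (a : Fin n → ℤ) : toRat (appendZero a) = appendZero (toRat a) := by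
  ext i
  refine Fin.lastCases ?_ (fun j => ?_) i <;> simp [toRat, appendZero]

theorem extendHom_rootReflection {m : ℤ} {n : ℕ} (h : IsAdmissible m (n + 1))
    (a : roots 2 m n) :
    extendHom _ (zVec_last_pos h).ne' (rootReflection a) = rootReflection (extendRoot a) := by
  ext1 x
  obtain ⟨⟨u, c⟩, rfl⟩ := (splitEquiv _ (zVec_last_pos h).ne').surjective x
  change extendHom _ _ _ (appendZero u + c • _) = rootReflection _ (appendZero u + c • _)
  have h1 : toRat (extendRoot a).1 = appendZero (toRat a.1) := toRat_appendZero _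
  have h2 : appendZero (toRat a.1) (Fin.last n) = 0 := by simp [appendZero]
  rw [extendHom_splitEquiv, rootReflection_apply, rootReflection_apply, h1, map_add, map_smul,
    form_zVec h.ne_zero, h2, form_appendZero_rat]
  ext i
  refine Fin.lastCases ?_ (fun j => ?_) i <;> simp [appendZero]
  ring

/-- A root orthogonal to `z` is a root of the smaller lattice. -/
theorem exists_extendRoot_eq {m : ℤ} {n : ℕ} (h : IsAdmissible m (n + 1))
    (a : roots 2 m (n + 1))
    (ha : form 2 m (n + 1) (toRat a.1) (zVec 2 m (n + 1) (Fin.last n)) = 0) :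
    ∃ b : roots 2 m n, extendRoot b = a := by
  rw [form_zVec h.ne_zero] at ha
  have h1 : a.1 (Fin.last n) = 0 := by
    have := (mul_eq_zero.1 ha).resolve_left (latticeDet_pos h).ne'
    exact Int.cast_injective (this.trans Int.cast_zero.symm)
  have h2 : appendZero (Fin.init (α := fun _ => ℤ) a.1) = a.1 := by
    ext i
    refine Fin.lastCases ?_ (fun j => ?_) i <;> simp [appendZero, Fin.init, h1]
  refine ⟨⟨Fin.init (α := fun _ => ℤ) a.1, ?_, ?_⟩, Subtype.ext h2⟩
  · have := a.2.1
    rw [← h2] at this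
    simpa only [lattice, Submodule.mem_comap, latitude_appendZero] using this
  · rw [← form_appendZero, h2]
    exact a.2.2

/-- The isotropy group of `z` is the extension of the smaller Weyl group. -/
theorem map_extendHom_weylGroup {m : ℤ} {n : ℕ} (h : IsAdmissible m (n + 1))
    (w : (Fin (n + 1) → ℚ) ≃ₗ[ℚ] (Fin (n + 1) → ℚ)) :
    w ∈ (weylGroup 2 m n).map (extendHom _ (zVec_last_pos h).ne') ↔
      w ∈ weylGroup 2 m (n + 1) ∧
        w (zVec 2 m (n + 1) (Fin.last n)) = zVec 2 m (n + 1) (Fin.last n) := by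
  constructor
  · rintro ⟨v, hv, rfl⟩
    constructor
    · have h1 : weylGroup 2 m n ≤
          (weylGroup 2 m (n + 1)).comap (extendHom _ (zVec_last_pos h).ne') := by
        refine (Subgroup.closure_le _).2 ?_
        rintro _ ⟨a, rfl⟩
        change extendHom _ _ _ ∈ weylGroup 2 m (n + 1)
        rw [extendHom_rootReflection h]
        exact Subgroup.subset_closure ⟨_, rfl⟩
      exact h1 hv
    · have h0 : appendZero (0 : Fin n → ℚ) = 0 := by
        ext i
        refine Fin.lastCases ?_ (fun j => ?_) i <;> simp [appendZero]
      have := extendHom_splitEquiv (zVec_last_pos h).ne' v 0 1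
      simpa [h0] using this
  · rintro ⟨h1, h2⟩
    have := finite_roots h
    have h3 := (rootFamily h).mem_closure_of_fixes (z := zVec 2 m (n + 1) (Fin.last n)) h1 h2
    refine (Subgroup.closure_le _).2 ?_ h3
    rintro _ ⟨a, ha, rfl⟩
    obtain ⟨b, rfl⟩ := exists_extendRoot_eq h a ha
    exact ⟨rootReflection b, Subgroup.subset_closure ⟨b, rfl⟩, extendHom_rootReflection h b⟩

/-- The homomorphism between Weyl groups that extends each automorphism by fixing `z`. -/
noncomputable def weylExtend {m : ℤ} {n : ℕ} (h : IsAdmissible m (n + 1)) :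
    weylGroup 2 m n →* weylGroup 2 m (n + 1) :=
  ((extendHom _ (zVec_last_pos h).ne').comp (weylGroup 2 m n).subtype).codRestrict _ fun w =>
    ((map_extendHom_weylGroup h _).1 ⟨w, w.2, rfl⟩).1

theorem weylExtend_injective {m : ℤ} {n : ℕ} (h : IsAdmissible m (n + 1)) :
    Function.Injective (weylExtend h) := fun _ _ hvw =>
  Subtype.ext (extendHom_injective (zVec_last_pos h).ne' (congrArg Subtype.val hvw))

theorem range_weylExtend {m : ℤ} {n : ℕ} (h : IsAdmissible m (n + 1)) :
    (weylExtend h).range =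
      MulAction.stabilizer (weylGroup 2 m (n + 1)) (zVec 2 m (n + 1) (Fin.last n)) := by
  ext w
  rw [MulAction.mem_stabilizer_iff]
  constructor
  · rintro ⟨v, rfl⟩
    exact ((map_extendHom_weylGroup h _).1 ⟨v, v.2, rfl⟩).2
  · intro hw
    obtain ⟨v, hv, hvw⟩ := (map_extendHom_weylGroup h w).2 ⟨w.2, hw⟩
    exact ⟨⟨v, hv⟩, Subtype.ext hvw⟩

theorem card_weylGroup_succ {m : ℤ} {n : ℕ} (h : IsAdmissible m (n + 1)) :
    Nat.card (weylGroup 2 m (n + 1)) = (zOrbit m n).ncard * Nat.card (weylGroup 2 m n) := by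
  rw [Nat.card_congr (MulAction.orbitProdStabilizerEquivGroup (weylGroup 2 m (n + 1))
    (zVec 2 m (n + 1) (Fin.last n))).symm, Nat.card_prod, ← range_weylExtend h,
    ← Nat.card_congr (MonoidHom.ofInjective (weylExtend_injective h)).toEquiv]
  rfl

theorem weylGroup_zero_subsingleton (m : ℤ) : Subsingleton (weylGroup 2 m 0) :=
  ⟨fun _ _ => Subtype.ext (by ext x i; exact i.elim0)⟩

theorem finite_weylGroup {m : ℤ} {n : ℕ} (h : IsAdmissible m n)
    (horb : ∀ n, IsAdmissible m (n + 1) → (zOrbit m n).Finite) : Finite (weylGroup 2 m n) := by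
  induction n with
  | zero =>
    have := weylGroup_zero_subsingleton m
    infer_instance
  | succ n ih =>
    have h1 := ih h.of_succ
    have h2 : Finite (MulAction.stabilizer (weylGroup 2 m (n + 1))
        (zVec 2 m (n + 1) (Fin.last n))) := by
      rw [← range_weylExtend h]
      exact .of_equiv _ (MonoidHom.ofInjective (weylExtend_injective h)).toEquiv
    have h3 : Finite (MulAction.orbit (weylGroup 2 m (n + 1))
        (zVec 2 m (n + 1) (Fin.last n))) := horb n h
    exact .of_equiv _ (MulAction.orbitProdStabilizerEquivGroup (weylGroup 2 m (n + 1))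
      (zVec 2 m (n + 1) (Fin.last n)))

/-! ### The orbit of `z` -/

/-- The integer vectors `y` with latitude `1 + m s` and squared length `1 + (m - 2) s²` for some
`s`. For `m = 3` they are the classes of the exceptional curves on a del Pezzo surface: `-s` is the
degree of the curve in the plane and `-y` the vector of its multiplicities at the `n` points. -/
def exceptional (m : ℤ) (n : ℕ) : Set (Fin n → ℤ) :=
  {y | ∃ s : ℤ, ∑ i, y i = 1 + m * s ∧ ∑ i, y i ^ 2 = 1 + (m - 2) * s ^ 2}

/-- The map `y ↦ (m - 2)(e_1 + ⋯ + e_n) + (det L) y`, which sends `e_j` to `z_j`. -/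
noncomputable def orbitMap (m : ℤ) (n : ℕ) (y : Fin n → ℤ) : Fin n → ℚ :=
  fun i => (m : ℚ) - 2 + latticeDet 2 m n * y i

theorem orbitMap_single (m : ℤ) (n : ℕ) (j : Fin n) :
    orbitMap m n (Pi.single j 1) = zVec 2 m n j := by
  ext i
  by_cases h : i = j
  · subst h
    simp [orbitMap, zVec]
  · simp [orbitMap, zVec, h]

theorem orbitMap_injective {m : ℤ} {n : ℕ} (h : IsAdmissible m (n + 1)) :
    Function.Injective (orbitMap m (n + 1)) := fun x y hxy => by
  ext i
  have h1 := congrFun hxy i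
  simp only [orbitMap, add_right_inj] at h1
  exact Int.cast_injective (mul_left_cancel₀ (latticeDet_pos h).ne' h1)

/-- The reflection in a root `a` of latitude `m t`, transported by `orbitMap`. -/
theorem rootReflection_orbitMap {m : ℤ} (hm : m ≠ 0) {n : ℕ} (a : roots 2 m (n + 1))
    {y : Fin (n + 1) → ℤ} {s t : ℤ} (ht : ∑ i, a.1 i = m * t) (hs : ∑ i, y i = 1 + m * s) :
    rootReflection a (orbitMap m (n + 1) y) =
      orbitMap m (n + 1) (y - (∑ i, a.1 i * y i - (m - 2) * t * s) • a.1) := by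
  have hm' : (m : ℚ) ≠ 0 := by exact_mod_cast hm
  have hd := latticeDet_succ 2 hm n
  set d := latticeDet 2 m (n + 1)
  have ht' : ∑ i, (a.1 i : ℚ) = m * t := by exact_mod_cast ht
  have hs' : ∑ i, (y i : ℚ) = 1 + m * s := by exact_mod_cast hs
  have h1 : form 2 m (n + 1) (toRat a.1) (orbitMap m (n + 1) y) =
      d * (∑ i, (a.1 i : ℚ) * y i - (m - 2) * t * s) := by
    have h2 : ∑ i, toRat a.1 i * orbitMap m (n + 1) y i =
        (m - 2) * (m * t) + d * ∑ i, (a.1 i : ℚ) * y i := by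
      rw [← ht', Finset.mul_sum, Finset.mul_sum, ← Finset.sum_add_distrib]
      exact Finset.sum_congr rfl fun i _ => by simp only [toRat, orbitMap]; ring
    have h3 : ∑ i, orbitMap m (n + 1) y i = m ^ 2 + d * m * s := by
      simp only [orbitMap, Finset.sum_add_distrib, ← Finset.mul_sum, hs']
      simp only [Finset.sum_const, Finset.card_univ, Fintype.card_fin, nsmul_eq_mul]
      rw [mul_add, mul_one]
      push_cast at hd ⊢
      linear_combination hd
    rw [form_apply, h2, h3, show ∑ i, toRat a.1 i = m * t from ht']
    push_cast
    field_simp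
    ring
  rw [rootReflection_apply, h1]
  ext i
  simp only [orbitMap, toRat, Pi.sub_apply, Pi.smul_apply, smul_eq_mul]
  push_cast
  ring

theorem sub_smul_root_mem_exceptional {m : ℤ} {n : ℕ} {a y : Fin n → ℤ} {s t : ℤ}
    (ht : ∑ i, a i = m * t) (ha : ∑ i, a i ^ 2 = 2 + (m - 2) * t ^ 2)
    (hs : ∑ i, y i = 1 + m * s) (hy : ∑ i, y i ^ 2 = 1 + (m - 2) * s ^ 2) :
    y - (∑ i, a i * y i - (m - 2) * t * s) • a ∈ exceptional m n := by
  set q := ∑ i, a i * y i - (m - 2) * t * s with hq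
  have hay : ∑ i, a i * y i = q + (m - 2) * t * s := by rw [hq]; ring
  refine ⟨s - q * t, ?_, ?_⟩
  · simp only [Pi.sub_apply, Pi.smul_apply, smul_eq_mul, Finset.sum_sub_distrib, ← Finset.mul_sum,
      hs, ht]
    ring
  · have h1 : ∑ i, (y - q • a) i ^ 2 =
        ∑ i, y i ^ 2 - 2 * q * ∑ i, a i * y i + q ^ 2 * ∑ i, a i ^ 2 := by
      rw [Finset.mul_sum, Finset.mul_sum, ← Finset.sum_sub_distrib, ← Finset.sum_add_distrib]
      exact Finset.sum_congr rfl fun i _ => by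
        simp only [Pi.sub_apply, Pi.smul_apply, smul_eq_mul]
        ring
    rw [h1, hy, ha, hay]
    ring

theorem rootReflection_inv {m : ℤ} {n : ℕ} (a : roots 2 m n) :
    (rootReflection a)⁻¹ = rootReflection a :=
  inv_eq_of_mul_eq_one_left (by ext1 x; exact Module.involutive_reflection a.2.2 x)

theorem single_mem_exceptional (m : ℤ) {n : ℕ} (i : Fin n) :
    (Pi.single i 1 : Fin n → ℤ) ∈ exceptional m n :=
  ⟨0, by simp, by simp [Pi.single_apply]⟩

theorem zOrbit_subset {m : ℤ} (hm : m ≠ 0) (n : ℕ) :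
    zOrbit m n ⊆ orbitMap m (n + 1) '' exceptional m (n + 1) := by
  have hrefl : ∀ a : roots 2 m (n + 1), ∀ x ∈ orbitMap m (n + 1) '' exceptional m (n + 1),
      rootReflection a x ∈ orbitMap m (n + 1) '' exceptional m (n + 1) := by
    rintro a _ ⟨y, ⟨s, hs, hy⟩, rfl⟩
    obtain ⟨t, ht, ha⟩ := (mem_roots_iff hm).1 a.2
    exact ⟨_, sub_smul_root_mem_exceptional ht ha hs hy, (rootReflection_orbitMap hm a ht hs).symm⟩
  have hall : ∀ w ∈ weylGroup 2 m (n + 1), ∀ x ∈ orbitMap m (n + 1) '' exceptional m (n + 1),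
      w x ∈ orbitMap m (n + 1) '' exceptional m (n + 1) := by
    intro w hw
    induction hw using Subgroup.closure_induction'' with
    | one => exact fun x hx => hx
    | mem w hw =>
      obtain ⟨a, rfl⟩ := hw
      exact hrefl a
    | inv_mem w hw =>
      obtain ⟨a, rfl⟩ := hw
      rw [rootReflection_inv]
      exact hrefl a
    | mul v w _ _ hv hw => exact fun x hx => hv _ (hw x hx)
  rintro _ ⟨w, rfl⟩
  exact hall w w.2 _ ⟨_, single_mem_exceptional m _, orbitMap_single _ _ _⟩

/-- A vector lies over the orbit of `z` as soon as one of its mirror images does. -/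
theorem orbitMap_mem_zOrbit_of_reflection {m : ℤ} (hm : m ≠ 0) {n : ℕ} {a y : Fin (n + 1) → ℤ}
    {s t : ℤ} (ht : ∑ i, a i = m * t) (ha : ∑ i, a i ^ 2 = 2 + (m - 2) * t ^ 2)
    (hs : ∑ i, y i = 1 + m * s)
    (h : orbitMap m (n + 1) (y - (∑ i, a i * y i - (m - 2) * t * s) • a) ∈ zOrbit m n) :
    orbitMap m (n + 1) y ∈ zOrbit m n := by
  let α : roots 2 m (n + 1) := ⟨a, (mem_roots_iff hm).2 ⟨t, ht, ha⟩⟩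
  obtain ⟨w, hw⟩ := h
  refine ⟨(weylReflection α)⁻¹ * w, ?_⟩
  change ((weylReflection α)⁻¹ * w) • _ = _
  rw [mul_smul, inv_smul_eq_iff]
  exact hw.trans (rootReflection_orbitMap hm α ht hs).symm

theorem orbitMap_single_mem_zOrbit {m : ℤ} (hm : m ≠ 0) {n : ℕ} (i : Fin (n + 1)) :
    orbitMap m (n + 1) (Pi.single i 1) ∈ zOrbit m n := by
  have hlast : orbitMap m (n + 1) (Pi.single (Fin.last n) 1) ∈ zOrbit m n := by
    rw [orbitMap_single]
    exact MulAction.mem_orbit_self _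
  by_cases hi : i = Fin.last n
  · rwa [hi]
  have hi' : Fin.last n ≠ i := Ne.symm hi
  refine orbitMap_mem_zOrbit_of_reflection hm (s := 0) (t := 0)
    (a := Pi.single i 1 - Pi.single (Fin.last n) 1) (by simp) ?_ (by simp) ?_
  · simp [sub_sq, Pi.single_apply, Finset.sum_add_distrib, hi']
  · have h1 : ∑ j, (Pi.single i 1 - Pi.single (Fin.last n) 1 : Fin (n + 1) → ℤ) j *
        (Pi.single i 1 : Fin (n + 1) → ℤ) j = 1 := by
      simp [Pi.single_apply, hi]
    rw [h1]
    simpa using hlast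

theorem eq_single_or_eq_neg_single {n : ℕ} {y : Fin n → ℤ} (h : ∑ i, y i ^ 2 = 1) :
    ∃ i, y = Pi.single i 1 ∨ y = -Pi.single i 1 := by
  obtain ⟨i, -, hi⟩ : ∃ i ∈ Finset.univ, y i ^ 2 ≠ 0 :=
    Finset.exists_ne_zero_of_sum_ne_zero (by rw [h]; norm_num)
  have h1 : 0 < y i ^ 2 := lt_of_le_of_ne (sq_nonneg _) (Ne.symm hi)
  have h2 := Finset.add_sum_erase Finset.univ (fun j => y j ^ 2) (Finset.mem_univ i)
  have h3 : ∑ j ∈ Finset.univ.erase i, y j ^ 2 = 0 :=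
    le_antisymm (by linarith) (Finset.sum_nonneg fun j _ => sq_nonneg _)
  have h4 : ∀ j, j ≠ i → y j = 0 := fun j hj =>
    pow_eq_zero_iff two_ne_zero |>.1 <|
      (Finset.sum_eq_zero_iff_of_nonneg fun j _ => sq_nonneg (y j)).1 h3 j
        (Finset.mem_erase.2 ⟨hj, Finset.mem_univ j⟩)
  have h5 : y i ^ 2 = 1 := by linarith
  refine ⟨i, (mul_self_eq_one_iff.1 ((pow_two _).symm.trans h5)).imp ?_ ?_⟩
  all_goals
    intro h6
    ext j
    by_cases hj : j = i
    · subst hj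
      simp [h6]
    · simp [h4 j hj, hj]

theorem eq_single_of_sum_eq_one {n : ℕ} {y : Fin n → ℤ} (h1 : ∑ i, y i = 1)
    (h : ∑ i, y i ^ 2 = 1) : ∃ i, y = Pi.single i 1 := by
  obtain ⟨i, rfl | rfl⟩ := eq_single_or_eq_neg_single h
  · exact ⟨i, rfl⟩
  · simp at h1

/-! ### Types `A` and `D` -/

theorem eq_single_or_eq_zero_of_mem_exceptional_one {n : ℕ} {y : Fin n → ℤ}
    (hy : y ∈ exceptional 1 n) : (∃ i, y = Pi.single i 1) ∨ y = 0 := by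
  obtain ⟨s, hs, hy⟩ := hy
  have h0 : 0 ≤ ∑ i, y i ^ 2 := Finset.sum_nonneg fun i _ => sq_nonneg _
  have h1 : s ^ 2 ≤ 1 := by linarith
  have h2 : -1 ≤ s := by nlinarith
  have h3 : s ≤ 1 := by nlinarith
  by_cases h4 : s = 0
  · subst h4
    exact .inl (eq_single_of_sum_eq_one (by simpa using hs) (by simpa using hy))
  · have h5 : s ^ 2 = 1 := by
      obtain rfl | rfl : s = 1 ∨ s = -1 := by omega
      all_goals norm_num
    have h6 : ∑ i, y i ^ 2 = 0 := by rw [hy, h5]; norm_num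
    refine .inr (funext fun i => ?_)
    exact pow_eq_zero_iff two_ne_zero |>.1 <|
      (Finset.sum_eq_zero_iff_of_nonneg fun j _ => sq_nonneg (y j)).1 h6 i (Finset.mem_univ i)

theorem exceptional_one_eq (n : ℕ) :
    exceptional 1 n = Set.range fun o : Option (Fin n) => o.elim 0 fun i => Pi.single i 1 := by
  ext y
  constructor
  · intro hy
    rcases eq_single_or_eq_zero_of_mem_exceptional_one hy with ⟨i, rfl⟩ | rfl
    · exact ⟨some i, rfl⟩
    · exact ⟨none, rfl⟩
  · rintro ⟨_ | i, rfl⟩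
    · exact ⟨-1, by simp, by simp⟩
    · exact single_mem_exceptional 1 i

theorem ncard_exceptional_one (n : ℕ) : (exceptional 1 n).ncard = n + 1 := by
  rw [exceptional_one_eq, ← Set.image_univ, Set.InjOn.ncard_image, Set.ncard_univ]
  · simp
  · rintro (_ | i) - (_ | j) - h
    · rfl
    · simpa using congrFun h j
    · simpa using congrFun h i
    · by_contra hij
      have hij' : i ≠ j := fun h => hij (by rw [h])
      simpa [hij'] using congrFun h i

theorem orbitMap_mem_zOrbit_one {n : ℕ} {y : Fin (n + 1) → ℤ} (hy : y ∈ exceptional 1 (n + 1)) :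
    orbitMap 1 (n + 1) y ∈ zOrbit 1 n := by
  rcases eq_single_or_eq_zero_of_mem_exceptional_one hy with ⟨i, rfl⟩ | rfl
  · exact orbitMap_single_mem_zOrbit one_ne_zero i
  · -- the root `e_1` of latitude `1` moves `0` to `e_1`
    refine orbitMap_mem_zOrbit_of_reflection one_ne_zero (a := Pi.single 0 1) (s := -1) (t := 1)
      (by simp) (by simp [Pi.single_apply]) (by simp) ?_
    simpa using orbitMap_single_mem_zOrbit one_ne_zero (0 : Fin (n + 1))

theorem exceptional_two_eq (n : ℕ) :
    exceptional 2 n = Set.range (Sum.elim (fun i : Fin n => (Pi.single i 1 : Fin n → ℤ))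
      fun i => -Pi.single i 1) := by
  ext y
  constructor
  · rintro ⟨s, -, hy⟩
    obtain ⟨i, rfl | rfl⟩ := eq_single_or_eq_neg_single (y := y) (by simpa using hy)
    · exact ⟨.inl i, rfl⟩
    · exact ⟨.inr i, rfl⟩
  · rintro ⟨i | i, rfl⟩
    · exact single_mem_exceptional 2 i
    · exact ⟨-1, by simp, by simp [Pi.single_apply]⟩

theorem ncard_exceptional_two (n : ℕ) : (exceptional 2 n).ncard = 2 * n := by
  rw [exceptional_two_eq, ← Set.image_univ, Set.InjOn.ncard_image, Set.ncard_univ]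
  · simp [two_mul]
  · have hsingle : ∀ i j : Fin n, (Pi.single i 1 : Fin n → ℤ) = Pi.single j 1 → i = j := by
      intro i j h
      by_contra hij
      simpa [hij] using congrFun h i
    have hneg : ∀ i j : Fin n, (Pi.single i 1 : Fin n → ℤ) ≠ -Pi.single j 1 := by
      intro i j h
      have := congrArg (fun y : Fin n → ℤ => ∑ i, y i) h
      simp at this
    rintro (i | i) - (j | j) - h
    · exact congrArg Sum.inl (hsingle i j h)
    · exact absurd h (hneg i j)
    · exact absurd h.symm (hneg j i)
    · exact congrArg Sum.inr (hsingle i j (neg_injective h))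

theorem orbitMap_mem_zOrbit_two {n : ℕ} (hn : 1 ≤ n) {y : Fin (n + 1) → ℤ}
    (hy : y ∈ exceptional 2 (n + 1)) : orbitMap 2 (n + 1) y ∈ zOrbit 2 n := by
  rw [exceptional_two_eq] at hy
  obtain ⟨i | i, rfl⟩ := hy
  · exact orbitMap_single_mem_zOrbit two_ne_zero i
  · -- for `j ≠ i`, the root `e_i + e_j` moves `-e_i` to `e_j`
    have : Nontrivial (Fin (n + 1)) := Fin.nontrivial_iff_two_le.2 (by omega)
    obtain ⟨j, hj⟩ := exists_ne i
    have hj' := hj.symm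
    refine orbitMap_mem_zOrbit_of_reflection two_ne_zero (a := Pi.single i 1 + Pi.single j 1)
      (s := -1) (t := 1) ?_ ?_ (by simp) ?_
    · simp [Finset.sum_add_distrib]
    · simp [add_sq, Pi.single_apply, Finset.sum_add_distrib, hj]
    · have h1 : ∑ k, (Pi.single i 1 + Pi.single j 1 : Fin (n + 1) → ℤ) k *
          (-Pi.single i 1 : Fin (n + 1) → ℤ) k = -1 := by
        simp [Pi.single_apply, hj']
      simp only [Sum.elim_inr]
      rw [h1]
      simpa using orbitMap_single_mem_zOrbit two_ne_zero j

/-! ### Type `E` -/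

theorem sum_le_sum_sq {n : ℕ} (y : Fin n → ℤ) : ∑ i, y i ≤ ∑ i, y i ^ 2 :=
  Finset.sum_le_sum fun _ _ => Int.le_self_sq _

theorem degree_bounds {n : ℕ} (hn : n ≤ 8) {y : Fin n → ℤ} {s : ℤ} (hs : ∑ i, y i = 1 + 3 * s)
    (hy : ∑ i, y i ^ 2 = 1 + s ^ 2) : s ≤ 0 ∧ -7 ≤ s := by
  have hcs : (∑ i, y i) ^ 2 ≤ n * ∑ i, y i ^ 2 := by
    simpa using sq_sum_le_card_mul_sum_sq (s := Finset.univ) (f := y)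
  have hle := sum_le_sum_sq y
  rw [hs, hy] at hcs hle
  have hn' : (n : ℤ) * (1 + s ^ 2) ≤ 8 * (1 + s ^ 2) :=
    mul_le_mul_of_nonneg_right (by exact_mod_cast hn) (by positivity)
  have h1 : s ≤ 1 := by nlinarith
  have h2 : -7 ≤ s := by nlinarith
  refine ⟨?_, h2⟩
  by_contra! h3
  obtain rfl : s = 1 := by omega
  norm_num at hle

/-- Apart from the classes `e_i`, which have degree `0`, exceptional curves have nonnegative
multiplicities. -/
theorem multiplicity_nonneg {n : ℕ} (hn : n ≤ 8) {y : Fin n → ℤ} {s : ℤ}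
    (hs : ∑ i, y i = 1 + 3 * s) (hy : ∑ i, y i ^ 2 = 1 + s ^ 2) (hneg : s < 0) (i : Fin n) :
    y i ≤ 0 := by
  by_contra! hi
  have hcs := sq_sum_le_card_mul_sum_sq (s := Finset.univ.erase i) (f := y)
  rw [Finset.card_erase_of_mem (Finset.mem_univ i), Finset.card_univ, Fintype.card_fin] at hcs
  have h1 := Finset.add_sum_erase Finset.univ y (Finset.mem_univ i)
  have h2 := Finset.add_sum_erase Finset.univ (fun j => y j ^ 2) (Finset.mem_univ i)
  have h3 : 0 ≤ ∑ j ∈ Finset.univ.erase i, y j ^ 2 := Finset.sum_nonneg fun j _ => sq_nonneg _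
  have h4 : ((n - 1 : ℕ) : ℤ) * ∑ j ∈ Finset.univ.erase i, y j ^ 2 ≤
      7 * ∑ j ∈ Finset.univ.erase i, y j ^ 2 :=
    mul_le_mul_of_nonneg_right (by omega) h3
  have h5 : ∑ j ∈ Finset.univ.erase i, y j = 1 + 3 * s - y i := by linarith
  have h6 : ∑ j ∈ Finset.univ.erase i, y j ^ 2 = 1 + s ^ 2 - y i ^ 2 := by linarith
  rw [h6] at hcs h4
  rw [h5] at hcs
  nlinarith

/-- Noether's inequality: a curve of positive degree has three multiplicities whose sum exceeds the
degree. -/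
theorem exists_three_sum_lt {n : ℕ} (h3 : 3 ≤ n) (hn : n ≤ 8) {y : Fin n → ℤ} {s : ℤ}
    (hs : ∑ i, y i = 1 + 3 * s) (hy : ∑ i, y i ^ 2 = 1 + s ^ 2) (hneg : s < 0) :
    ∃ i j k, i ≠ j ∧ i ≠ k ∧ j ≠ k ∧ y i + y j + y k < s := by
  have hnonpos := multiplicity_nonneg hn hs hy hneg
  have hcard : (Finset.univ : Finset (Fin n)).card = n := by simp
  obtain ⟨i, hiu, hi⟩ := Finset.exists_min_image Finset.univ y
    (Finset.card_pos.1 (by omega))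
  have hcard1 := Finset.card_erase_of_mem hiu
  obtain ⟨j, hju, hj⟩ := Finset.exists_min_image (Finset.univ.erase i) y
    (Finset.card_pos.1 (by omega))
  have hcard2 := Finset.card_erase_of_mem hju
  obtain ⟨k, hku, hk⟩ := Finset.exists_min_image ((Finset.univ.erase i).erase j) y
    (Finset.card_pos.1 (by omega))
  have hji : j ≠ i := Finset.ne_of_mem_erase hju
  have hkj : k ≠ j := Finset.ne_of_mem_erase hku
  have hki : k ≠ i := Finset.ne_of_mem_erase (Finset.mem_of_mem_erase hku)
  refine ⟨i, j, k, hji.symm, hki.symm, hkj.symm, ?_⟩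
  by_contra! hle
  have hij : y i ≤ y j := hi j (Finset.mem_univ j)
  have hjk : y j ≤ y k := hj k (Finset.mem_of_mem_erase hku)
  have hk0 := hnonpos k
  have h1 : ∑ l ∈ (Finset.univ.erase i).erase j, y l * (y l - y k) ≤ 0 :=
    Finset.sum_nonpos fun l hl => mul_nonpos_of_nonpos_of_nonneg (hnonpos l)
      (sub_nonneg.2 (hk l hl))
  have h2 := Finset.add_sum_erase Finset.univ (fun l => y l * (y l - y k)) hiu
  have h4 := Finset.add_sum_erase (Finset.univ.erase i) (fun l => y l * (y l - y k)) hju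
  have h5 : ∑ l, y l * (y l - y k) = 1 + s ^ 2 - y k * (1 + 3 * s) := by
    rw [← hs, ← hy, Finset.mul_sum, ← Finset.sum_sub_distrib]
    exact Finset.sum_congr rfl fun l _ => by ring
  have h6 : 1 + s ^ 2 - y k * (1 + 3 * s) ≤ y i * (y i - y k) + y j * (y j - y k) := by
    linarith
  have h7 : 0 ≤ (y i + y j + y k - s) * (3 * y k - s) :=
    mul_nonneg (by linarith) (by linarith)
  have h8 : 0 ≤ (y k - y i) * (y k - y j) := mul_nonneg (by linarith) (by linarith)
  have h9 : 0 ≤ (y k - y i + (y k - y j)) * (y i + y j + y k - s) :=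
    mul_nonneg (by linarith) (by linarith)
  have h10 : 0 ≤ -y k * (y k - y i + (y k - y j)) := mul_nonneg (by linarith) (by linarith)
  nlinarith

/-- The quadratic transformation at three points lowers the degree, so that every exceptional class
is reached from a class of degree `0`. -/
theorem orbitMap_mem_zOrbit_three {n : ℕ} (h3 : 3 ≤ n + 1) (hn : n + 1 ≤ 8)
    {y : Fin (n + 1) → ℤ} (hy : y ∈ exceptional 3 (n + 1)) :
    orbitMap 3 (n + 1) y ∈ zOrbit 3 n := by
  obtain ⟨s, hs, hy⟩ := hy
  replace hy : ∑ i, y i ^ 2 = 1 + s ^ 2 := by rw [hy]; ring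
  induction hd : (-s).toNat using Nat.strong_induction_on generalizing y s with
  | _ d ih =>
  obtain ⟨hs0, -⟩ := degree_bounds hn hs hy
  by_cases hs1 : s = 0
  · subst hs1
    obtain ⟨i, rfl⟩ := eq_single_of_sum_eq_one (by simpa using hs) (by simpa using hy)
    exact orbitMap_single_mem_zOrbit three_ne_zero i
  obtain ⟨i, j, k, hij, hik, hjk, hlt⟩ := exists_three_sum_lt h3 hn hs hy (by omega)
  set a : Fin (n + 1) → ℤ := Pi.single i 1 + Pi.single j 1 + Pi.single k 1 with ha
  have hmul : ∀ x : Fin (n + 1) → ℤ, ∑ l, a l * x l = x i + x j + x k := by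
    intro x
    simp [ha, add_mul, Finset.sum_add_distrib, Pi.single_apply]
  have ha1 : ∑ l, a l = 3 * 1 := by simp [ha, Finset.sum_add_distrib]
  have ha2 : ∑ l, a l ^ 2 = 2 + (3 - 2) * 1 ^ 2 := by
    simp only [pow_two, hmul]
    simp [ha, hij, hik, hjk, hij.symm, hik.symm, hjk.symm]
  refine orbitMap_mem_zOrbit_of_reflection three_ne_zero ha1 ha2 hs ?_
  obtain ⟨s', hs', hy'⟩ := sub_smul_root_mem_exceptional ha1 ha2 hs
    (hy.trans (by ring : 1 + s ^ 2 = 1 + (3 - 2) * s ^ 2))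
  replace hy' := hy'.trans (by ring : 1 + (3 - 2) * s' ^ 2 = 1 + s' ^ 2)
  refine ih _ ?_ s' hs' hy' rfl
  obtain ⟨hs0', -⟩ := degree_bounds hn hs' hy'
  have h1 : s' = s - (∑ l, a l * y l - (3 - 2) * 1 * s) := by
    have : ∑ l, (y - (∑ l, a l * y l - (3 - 2) * 1 * s) • a) l =
        1 + 3 * (s - (∑ l, a l * y l - (3 - 2) * 1 * s)) := by
      simp only [Pi.sub_apply, Pi.smul_apply, smul_eq_mul, Finset.sum_sub_distrib,
        ← Finset.mul_sum, hs, ha1]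
      ring
    linarith
  rw [hmul] at h1
  omega

/-! ### The orbit in all types -/

theorem zOrbit_eq {m : ℤ} {n : ℕ} (h : IsADE m (n + 1)) :
    zOrbit m n = orbitMap m (n + 1) '' exceptional m (n + 1) := by
  refine (zOrbit_subset h.isAdmissible.ne_zero n).antisymm ?_
  rintro _ ⟨y, hy, rfl⟩
  rcases h with ⟨rfl, -⟩ | ⟨rfl, hn⟩ | ⟨rfl, h3, h8⟩
  · exact orbitMap_mem_zOrbit_one hy
  · exact orbitMap_mem_zOrbit_two (by omega) hy
  · exact orbitMap_mem_zOrbit_three h3 h8 hy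

theorem ncard_zOrbit {m : ℤ} {n : ℕ} (h : IsADE m (n + 1)) :
    (zOrbit m n).ncard = (exceptional m (n + 1)).ncard := by
  rw [zOrbit_eq h, Set.ncard_image_of_injective _ (orbitMap_injective h.isAdmissible)]

theorem finite_zOrbit {m : ℤ} {n : ℕ} (h : IsAdmissible m (n + 1)) : (zOrbit m n).Finite := by
  refine Set.Finite.subset (Set.Finite.image _ ?_) (zOrbit_subset h.ne_zero n)
  refine (finite_setOf_sum_sq_le (n + 1) 50).subset ?_
  rintro y ⟨s, hs, hy⟩
  change ∑ i, y i ^ 2 ≤ 50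
  rw [hy]
  rcases h with rfl | rfl | ⟨rfl, hn⟩
  · nlinarith
  · norm_num
  · obtain ⟨h1, h2⟩ := degree_bounds hn hs (by rw [hy]; ring)
    nlinarith

/-! ### Counting integer vectors of given sum and squared length -/

/-- The number of integer vectors of length `n` with sum `S` and sum of squares `Q < 16`, computed
entry by entry. The Cauchy-Schwarz inequality prunes the search. -/
def countVectors : ℕ → ℤ → ℤ → ℕ
  | 0, S, Q => if S = 0 ∧ Q = 0 then 1 else 0
  | n + 1, S, Q =>
    if (n + 1 : ℕ) * Q < S * S then 0
    else countVectors n (S + 3) (Q - 9) + countVectors n (S + 2) (Q - 4) +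
      countVectors n (S + 1) (Q - 1) + countVectors n S Q + countVectors n (S - 1) (Q - 1) +
      countVectors n (S - 2) (Q - 4) + countVectors n (S - 3) (Q - 9)

/-- The integer vectors of length `n` with sum `S` and sum of squares `Q`. -/
noncomputable def sumSqVectors (n : ℕ) (S Q : ℤ) : Finset (Fin n → ℤ) :=
  ((finite_setOf_sum_sq_le n Q).subset
    (t := {y | ∑ i, y i = S ∧ ∑ i, y i ^ 2 = Q}) fun _ hy => hy.2.le).toFinset

@[simp] theorem mem_sumSqVectors {n : ℕ} {S Q : ℤ} {y : Fin n → ℤ} :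
    y ∈ sumSqVectors n S Q ↔ ∑ i, y i = S ∧ ∑ i, y i ^ 2 = Q := by
  simp [sumSqVectors]

theorem card_filter_sumSqVectors (n : ℕ) (S Q v : ℤ) :
    ((sumSqVectors (n + 1) S Q).filter fun y => y 0 = v).card =
      (sumSqVectors n (S - v) (Q - v ^ 2)).card := by
  refine Finset.card_nbij' Fin.tail (Fin.cons (α := fun _ => ℤ) v) ?_ ?_ ?_ ?_
  · intro y hy
    simp only [Finset.coe_filter, Set.mem_ofPred_eq, mem_sumSqVectors, Fin.sum_univ_succ] at hy
    obtain ⟨⟨h1, h2⟩, h3⟩ := hy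
    simp only [Finset.mem_coe, mem_sumSqVectors, Fin.tail]
    rw [h3] at h1 h2
    exact ⟨by linarith, by linarith⟩
  · intro y hy
    simp only [Finset.mem_coe, mem_sumSqVectors] at hy
    simp [Fin.sum_univ_succ, hy.1, hy.2]
  · intro y hy
    simp only [Finset.coe_filter, Set.mem_ofPred_eq] at hy
    rw [← hy.2]
    exact Fin.cons_self_tail y
  · intro y _
    exact Fin.tail_cons (α := fun _ => ℤ) v y

theorem card_sumSqVectors (n : ℕ) (S : ℤ) {Q : ℤ} (hQ : Q < 16) :
    (sumSqVectors n S Q).card = countVectors n S Q := by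
  induction n generalizing S Q with
  | zero =>
    rw [countVectors]
    split_ifs with h
    · refine Finset.card_eq_one.2 ⟨0, ?_⟩
      ext y
      simp [h.1, h.2, Subsingleton.elim y 0]
    · refine Finset.card_eq_zero.2 (Finset.eq_empty_of_forall_notMem fun y hy => h ?_)
      simpa [eq_comm] using hy
  | succ n ih =>
    rw [countVectors]
    split_ifs with h
    · refine Finset.card_eq_zero.2 (Finset.eq_empty_of_forall_notMem fun y hy => ?_)
      rw [mem_sumSqVectors] at hy
      have hcs := sq_sum_le_card_mul_sum_sq (s := Finset.univ) (f := y)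
      rw [hy.1, hy.2, Finset.card_univ, Fintype.card_fin, pow_two] at hcs
      exact hcs.not_gt h
    · have hmaps : ∀ y ∈ sumSqVectors (n + 1) S Q, y 0 ∈ Finset.Icc (-3 : ℤ) 3 := by
        intro y hy
        rw [mem_sumSqVectors] at hy
        have h1 : y 0 ^ 2 ≤ ∑ i, y i ^ 2 :=
          Finset.single_le_sum (f := fun i => y i ^ 2) (fun i _ => sq_nonneg _)
            (Finset.mem_univ 0)
        rw [hy.2] at h1
        rw [Finset.mem_Icc]
        constructor <;> nlinarith
      rw [Finset.card_eq_sum_card_fiberwise hmaps]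
      simp only [card_filter_sumSqVectors]
      rw [Finset.sum_congr rfl fun v _ => ih (S - v)
        (show Q - v ^ 2 < 16 by have := sq_nonneg v; linarith)]
      rw [show Finset.Icc (-3 : ℤ) 3 = {-3, -2, -1, 0, 1, 2, 3} by decide]
      simp
      ring

theorem ncard_setOf_exists_sum_sq {n : ℕ} {T : Finset ℤ} {f g : ℤ → ℤ}
    (hf : Function.Injective f) (hg : ∀ s ∈ T, g s < 16) :
    {y : Fin n → ℤ | ∃ s ∈ T, ∑ i, y i = f s ∧ ∑ i, y i ^ 2 = g s}.ncard =
      ∑ s ∈ T, countVectors n (f s) (g s) := by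
  have h1 : {y : Fin n → ℤ | ∃ s ∈ T, ∑ i, y i = f s ∧ ∑ i, y i ^ 2 = g s} =
      (T.biUnion fun s => sumSqVectors n (f s) (g s) : Finset (Fin n → ℤ)) := by
    ext y
    simp only [Set.mem_ofPred_eq, Finset.coe_biUnion, Set.mem_iUnion, Finset.mem_coe,
      mem_sumSqVectors, exists_prop]
  rw [h1, Set.ncard_coe_finset, Finset.card_biUnion]
  · exact Finset.sum_congr rfl fun s hs => card_sumSqVectors n _ (hg s hs)
  · intro s _ t _ hst
    refine Finset.disjoint_left.2 fun y hs ht => hst (hf ?_)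
    rw [mem_sumSqVectors] at hs ht
    exact hs.1.symm.trans ht.1

/-- On the blowup of at most seven points, exceptional curves have degree at most `3`. -/
theorem exceptional_three_eq {n : ℕ} (hn : n ≤ 7) :
    exceptional 3 n =
      {y | ∃ s ∈ Finset.Icc (-3 : ℤ) 0, ∑ i, y i = 1 + 3 * s ∧ ∑ i, y i ^ 2 = 1 + s ^ 2} := by
  ext y
  constructor
  · rintro ⟨s, hs, hy⟩
    replace hy : ∑ i, y i ^ 2 = 1 + s ^ 2 := by rw [hy]; ring
    have hcs : (∑ i, y i) ^ 2 ≤ n * ∑ i, y i ^ 2 := by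
      simpa using sq_sum_le_card_mul_sum_sq (s := Finset.univ) (f := y)
    rw [hs, hy] at hcs
    have hn' : (n : ℤ) * (1 + s ^ 2) ≤ 7 * (1 + s ^ 2) :=
      mul_le_mul_of_nonneg_right (by exact_mod_cast hn) (by positivity)
    exact ⟨s, Finset.mem_Icc.2 ⟨by nlinarith, (degree_bounds (by omega) hs hy).1⟩, hs, hy⟩
  · rintro ⟨s, -, hs, hy⟩
    exact ⟨s, hs, by rw [hy]; ring⟩

theorem ncard_exceptional_three {n : ℕ} (hn : n ≤ 7) :
    (exceptional 3 n).ncard =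
      ∑ s ∈ Finset.Icc (-3 : ℤ) 0, countVectors n (1 + 3 * s) (1 + s ^ 2) := by
  rw [exceptional_three_eq hn]
  refine ncard_setOf_exists_sum_sq (f := fun s => 1 + 3 * s) (g := fun s => 1 + s ^ 2) ?_ ?_
  · intro s t h
    have h' : 1 + 3 * s = 1 + 3 * t := h
    omega
  · intro s hs
    rw [Finset.mem_Icc] at hs
    have : s ^ 2 ≤ 9 := by nlinarith
    omega

theorem roots_three_eight_eq :
    roots 2 3 8 =
      {a | ∃ t ∈ Finset.Icc (-3 : ℤ) 3, ∑ i, a i = 3 * t ∧ ∑ i, a i ^ 2 = 2 + t ^ 2} := by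
  ext a
  rw [mem_roots_iff three_ne_zero]
  constructor
  · rintro ⟨t, ht, ha⟩
    replace ha : ∑ i, a i ^ 2 = 2 + t ^ 2 := by rw [ha]; ring
    have hcs : (∑ i, a i) ^ 2 ≤ 8 * ∑ i, a i ^ 2 := by
      simpa using sq_sum_le_card_mul_sum_sq (s := Finset.univ) (f := a)
    rw [ht, ha] at hcs
    have h1 : -4 ≤ t := by nlinarith
    have h2 : t ≤ 4 := by nlinarith
    -- latitude `± 12` would need eight entries `± 3/2`
    have h3 : ∀ e : ℤ, e ^ 2 = 1 →
        0 ≤ ∑ i, a i ^ 2 - 3 * e * ∑ i, a i + 8 * (2 * e ^ 2) := by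
      intro e he
      have h4 : ∑ i, a i ^ 2 - 3 * e * ∑ i, a i + 8 * (2 * e ^ 2) =
          ∑ i, (a i - e) * (a i - 2 * e) := by
        rw [Finset.mul_sum, ← Finset.sum_sub_distrib,
          show (8 : ℤ) * (2 * e ^ 2) = ∑ _i : Fin 8, 2 * e ^ 2 by simp,
          ← Finset.sum_add_distrib]
        exact Finset.sum_congr rfl fun i _ => by ring
      rw [h4]
      refine Finset.sum_nonneg fun i _ => ?_
      have h5 := Int.le_self_sq (e * a i - 1)
      nlinarith
    have h4 : t ≠ 4 := by
      rintro rfl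
      have := h3 1 (by norm_num)
      rw [ht, ha] at this
      norm_num at this
    have h5 : t ≠ -4 := by
      rintro rfl
      have := h3 (-1) (by norm_num)
      rw [ht, ha] at this
      norm_num at this
    exact ⟨t, Finset.mem_Icc.2 ⟨by omega, by omega⟩, ht, ha⟩
  · rintro ⟨t, -, ht, ha⟩
    exact ⟨t, ht, by rw [ha]; ring⟩

theorem ncard_roots_three_eight : (roots 2 3 8).ncard = 240 := by
  rw [roots_three_eight_eq, ncard_setOf_exists_sum_sq (f := fun t => 3 * t)
    (g := fun t => 2 + t ^ 2)]
  · decide +kernel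
  · intro s t h
    have h' : 3 * s = 3 * t := h
    omega
  · intro s hs
    rw [Finset.mem_Icc] at hs
    have : s ^ 2 ≤ 9 := by nlinarith
    omega

/-- For `m = 3`, `n = 8` the map `orbitMap` is the translation by `e_1 + ⋯ + e_8`, under which the
exceptional classes become the roots. -/
theorem orbitMap_image_exceptional_three_eight :
    orbitMap 3 8 '' exceptional 3 8 = toRat '' roots 2 3 8 := by
  have hd : latticeDet 2 3 8 = 1 := by
    rw [latticeDet_succ 2 three_ne_zero 7]
    norm_num
  have hmap : ∀ y : Fin 8 → ℤ, orbitMap 3 8 y = toRat fun i => y i + 1 := by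
    intro y
    ext i
    simp only [orbitMap, toRat, hd]
    push_cast
    ring
  have hsum : ∀ y : Fin 8 → ℤ, ∑ i, (y i + 1) = ∑ i, y i + 8 := by
    intro y
    simp [Finset.sum_add_distrib]
  have hsq : ∀ y : Fin 8 → ℤ, ∑ i, (y i + 1) ^ 2 = ∑ i, y i ^ 2 + 2 * ∑ i, y i + 8 := by
    intro y
    simp only [add_sq, Finset.sum_add_distrib, Finset.mul_sum]
    simp
  have hiff : ∀ y : Fin 8 → ℤ, y ∈ exceptional 3 8 ↔ (fun i => y i + 1) ∈ roots 2 3 8 := by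
    intro y
    rw [mem_roots_iff three_ne_zero, hsum, hsq]
    constructor
    · rintro ⟨s, hs, hy⟩
      exact ⟨s + 3, by rw [hs]; ring, by rw [hs, hy]; ring⟩
    · rintro ⟨t, ht, ha⟩
      have h1 : ∑ i, y i = 3 * t - 8 := by linarith
      rw [h1] at ha
      exact ⟨t - 3, by rw [h1]; ring, by linear_combination ha⟩
  ext x
  constructor
  · rintro ⟨y, hy, rfl⟩
    exact ⟨_, (hiff y).1 hy, (hmap y).symm⟩
  · rintro ⟨a, ha, rfl⟩
    refine ⟨fun i => a i - 1, (hiff _).2 (by simpa using ha), ?_⟩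
    rw [hmap]
    simp

/-! ### The shapes of the orbits of types `E_6` and `E_7` -/

theorem eq_or_eq_add_one_of_sum_eq {n : ℕ} {y : Fin n → ℤ} {p q : ℕ} {c : ℤ} (hpq : p + q = n)
    (h1 : ∑ i, y i = p * c + q * (c + 1)) (h2 : ∑ i, y i ^ 2 = p * c ^ 2 + q * (c + 1) ^ 2)
    (i : Fin n) : y i = c ∨ y i = c + 1 := by
  -- the sum of the products `(y_i - c)(y_i - c - 1)`, none of which is negative, is zero
  have hnonneg : ∀ i, 0 ≤ (y i - c) * (y i - (c + 1)) := fun i => by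
    have := Int.le_self_sq (y i - c)
    nlinarith
  have h3 : ∑ i, (y i - c) * (y i - (c + 1)) = 0 := by
    have h4 : ∑ i, (y i - c) * (y i - (c + 1)) =
        ∑ i, y i ^ 2 - (2 * c + 1) * ∑ i, y i + n * (c * (c + 1)) := by
      rw [Finset.mul_sum, ← Finset.sum_sub_distrib,
        show (n : ℤ) * (c * (c + 1)) = ∑ _i : Fin n, c * (c + 1) by simp,
        ← Finset.sum_add_distrib]
      exact Finset.sum_congr rfl fun i _ => by ring
    rw [h4, h1, h2, ← hpq]
    push_cast
    ring
  have h5 := (Finset.sum_eq_zero_iff_of_nonneg fun i _ => hnonneg i).1 h3 i (Finset.mem_univ i)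
  exact (mul_eq_zero.1 h5).imp sub_eq_zero.1 sub_eq_zero.1

/-- A vector consists of `p` entries `c` and `q` entries `c + 1` as soon as it has the same sum and
the same sum of squares as such a vector. -/
theorem map_eq_replicate_iff {n : ℕ} {y : Fin n → ℤ} {p q : ℕ} {c : ℤ} (hpq : p + q = n) :
    Finset.univ.val.map y = Multiset.replicate p c + Multiset.replicate q (c + 1) ↔
      ∑ i, y i = p * c + q * (c + 1) ∧ ∑ i, y i ^ 2 = p * c ^ 2 + q * (c + 1) ^ 2 := by
  constructor
  · intro h
    constructor
    · change (Finset.univ.val.map y).sum = _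
      rw [h]
      simp
    · have h1 : ∑ i, y i ^ 2 = ((Finset.univ.val.map y).map fun v => v ^ 2).sum := by
        rw [Multiset.map_map]
        rfl
      rw [h1, h]
      simp
  · rintro ⟨h1, h2⟩
    have hy := eq_or_eq_add_one_of_sum_eq hpq h1 h2
    set M := (Finset.univ : Finset (Fin n)).val.map y with hM
    have hsum : M.sum = p * c + q * (c + 1) := h1
    have hcard : M.card = n := by simp [hM]
    have hdecomp : M = Multiset.replicate (M.count c) c +
        Multiset.replicate ((M.filter fun v => ¬v = c).card) (c + 1) := by
      conv_lhs => rw [← Multiset.filter_add_not (fun v => v = c) M]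
      congr 1
      · exact Multiset.filter_eq' M c
      · refine Multiset.eq_replicate_card.2 fun v hv => ?_
        obtain ⟨hvM, hvc⟩ := Multiset.mem_filter.1 hv
        obtain ⟨i, -, rfl⟩ := Multiset.mem_map.1 hvM
        exact (hy i).resolve_left hvc
    set P := M.count c
    set N := (M.filter fun v => ¬v = c).card
    rw [hdecomp] at hsum hcard
    simp only [Multiset.sum_add, Multiset.sum_replicate, nsmul_eq_mul, Multiset.card_add,
      Multiset.card_replicate] at hsum hcard
    have hcard' : (P : ℤ) + N = p + q := by exact_mod_cast hcard.trans hpq.symm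
    have hN : (N : ℤ) = q := by linear_combination hsum - c * hcard'
    have hP : (P : ℤ) = p := by linarith
    rw [hdecomp, show P = p by exact_mod_cast hP, show N = q by exact_mod_cast hN]

theorem shape_eq_shapeOf_iff {n : ℕ} {x : Fin n → ℚ} {p q : ℕ} {c : ℤ} {d : ℚ} (hd : d ≠ 0)
    (hpq : p + q = n) :
    shape x = shapeOf (1 + d * c) p (1 + d * (c + 1)) q ↔
      ∃ y : Fin n → ℤ, (∑ i, y i = p * c + q * (c + 1) ∧
        ∑ i, y i ^ 2 = p * c ^ 2 + q * (c + 1) ^ 2) ∧ (fun i => 1 + d * (y i : ℚ)) = x := by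
  have hinj : Function.Injective fun v : ℤ => 1 + d * (v : ℚ) := fun u v h => by
    simp only [add_right_inj] at h
    exact Int.cast_injective (mul_left_cancel₀ hd h)
  have hmap : shapeOf (1 + d * c) p (1 + d * (c + 1)) q =
      (Multiset.replicate p c + Multiset.replicate q (c + 1)).map
        fun v : ℤ => 1 + d * (v : ℚ) := by
    simp [shapeOf]
  have hshape : ∀ y : Fin n → ℤ, shape (fun i => 1 + d * (y i : ℚ)) =
      (Finset.univ.val.map y).map fun v : ℤ => 1 + d * (v : ℚ) := fun y => by
    simp [shape, Function.comp_def]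
  constructor
  · intro h
    have hx : ∀ i, ∃ v : ℤ, 1 + d * (v : ℚ) = x i := by
      intro i
      have h1 : x i ∈ shape x := Multiset.mem_map_of_mem x (Finset.mem_univ_val i)
      rw [h, hmap] at h1
      obtain ⟨v, -, hv⟩ := Multiset.mem_map.1 h1
      exact ⟨v, hv⟩
    choose y hy using hx
    obtain rfl : (fun i => 1 + d * (y i : ℚ)) = x := funext hy
    refine ⟨y, (map_eq_replicate_iff hpq).1 ?_, rfl⟩
    rw [hshape, hmap] at h
    exact Multiset.map_injective hinj h
  · rintro ⟨y, hy, rfl⟩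
    rw [hshape, hmap, (map_eq_replicate_iff hpq).2 hy]

theorem orbitMap_image_exceptional_three_six :
    orbitMap 3 6 '' exceptional 3 6 =
      {x | shape x = shapeOf 1 5 4 1 ∨ shape x = shapeOf (-2) 2 1 4 ∨
        shape x = shapeOf (-2) 5 1 1} := by
  have hd : latticeDet 2 3 6 = 3 := by
    rw [latticeDet_succ 2 three_ne_zero 5]
    norm_num
  have hmap : orbitMap 3 6 = fun y i => 1 + 3 * (y i : ℚ) := by
    funext y i
    simp only [orbitMap, hd]
    norm_num
  have e1 := fun x : Fin 6 → ℚ => shape_eq_shapeOf_iff (x := x) (p := 5) (q := 1) (c := 0)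
    (three_ne_zero (α := ℚ)) rfl
  have e2 := fun x : Fin 6 → ℚ => shape_eq_shapeOf_iff (x := x) (p := 2) (q := 4) (c := -1)
    (three_ne_zero (α := ℚ)) rfl
  have e3 := fun x : Fin 6 → ℚ => shape_eq_shapeOf_iff (x := x) (p := 5) (q := 1) (c := -1)
    (three_ne_zero (α := ℚ)) rfl
  norm_num at e1 e2 e3
  ext x
  rw [Set.mem_ofPred_eq, e1, e2, e3, exceptional_three_eq (by norm_num), hmap]
  constructor
  · rintro ⟨y, ⟨s, hs, h1, h2⟩, rfl⟩
    have hcs : (∑ i, y i) ^ 2 ≤ 6 * ∑ i, y i ^ 2 := by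
      simpa using sq_sum_le_card_mul_sum_sq (s := Finset.univ) (f := y)
    rw [Finset.mem_Icc] at hs
    obtain rfl | rfl | rfl | rfl : s = 0 ∨ s = -1 ∨ s = -2 ∨ s = -3 := by omega
    · exact .inl ⟨y, ⟨h1, h2⟩, rfl⟩
    · exact .inr (.inl ⟨y, ⟨h1, h2⟩, rfl⟩)
    · exact .inr (.inr ⟨y, ⟨h1, h2⟩, rfl⟩)
    · rw [h1, h2] at hcs
      norm_num at hcs
  · rintro (⟨y, ⟨h1, h2⟩, rfl⟩ | ⟨y, ⟨h1, h2⟩, rfl⟩ | ⟨y, ⟨h1, h2⟩, rfl⟩)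
    · exact ⟨y, ⟨0, by decide, h1, h2⟩, rfl⟩
    · exact ⟨y, ⟨-1, by decide, by rw [h1]; rfl, by rw [h2]; rfl⟩, rfl⟩
    · exact ⟨y, ⟨-2, by decide, by rw [h1]; rfl, by rw [h2]; rfl⟩, rfl⟩

theorem orbitMap_image_exceptional_three_seven :
    orbitMap 3 7 '' exceptional 3 7 =
      {x | shape x = shapeOf 1 6 3 1 ∨ shape x = shapeOf (-1) 2 1 5 ∨
        shape x = shapeOf (-1) 5 1 2 ∨ shape x = shapeOf (-3) 1 (-1) 6} := by
  have hd : latticeDet 2 3 7 = 2 := by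
    rw [latticeDet_succ 2 three_ne_zero 6]
    norm_num
  have hmap : orbitMap 3 7 = fun y i => 1 + 2 * (y i : ℚ) := by
    funext y i
    simp only [orbitMap, hd]
    norm_num
  have e1 := fun x : Fin 7 → ℚ => shape_eq_shapeOf_iff (x := x) (p := 6) (q := 1) (c := 0)
    (two_ne_zero (α := ℚ)) rfl
  have e2 := fun x : Fin 7 → ℚ => shape_eq_shapeOf_iff (x := x) (p := 2) (q := 5) (c := -1)
    (two_ne_zero (α := ℚ)) rfl
  have e3 := fun x : Fin 7 → ℚ => shape_eq_shapeOf_iff (x := x) (p := 5) (q := 2) (c := -1)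
    (two_ne_zero (α := ℚ)) rfl
  have e4 := fun x : Fin 7 → ℚ => shape_eq_shapeOf_iff (x := x) (p := 1) (q := 6) (c := -2)
    (two_ne_zero (α := ℚ)) rfl
  norm_num at e1 e2 e3 e4
  ext x
  rw [Set.mem_ofPred_eq, e1, e2, e3, e4, exceptional_three_eq le_rfl, hmap]
  constructor
  · rintro ⟨y, ⟨s, hs, h1, h2⟩, rfl⟩
    rw [Finset.mem_Icc] at hs
    obtain rfl | rfl | rfl | rfl : s = 0 ∨ s = -1 ∨ s = -2 ∨ s = -3 := by omega
    · exact .inl ⟨y, ⟨h1, h2⟩, rfl⟩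
    · exact .inr (.inl ⟨y, ⟨h1, h2⟩, rfl⟩)
    · exact .inr (.inr (.inl ⟨y, ⟨h1, h2⟩, rfl⟩))
    · exact .inr (.inr (.inr ⟨y, ⟨h1, h2⟩, rfl⟩))
  · rintro (⟨y, ⟨h1, h2⟩, rfl⟩ | ⟨y, ⟨h1, h2⟩, rfl⟩ | ⟨y, ⟨h1, h2⟩, rfl⟩ | ⟨y, ⟨h1, h2⟩, rfl⟩)
    · exact ⟨y, ⟨0, by decide, h1, h2⟩, rfl⟩
    · exact ⟨y, ⟨-1, by decide, by rw [h1]; rfl, by rw [h2]; rfl⟩, rfl⟩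
    · exact ⟨y, ⟨-2, by decide, by rw [h1]; rfl, by rw [h2]; rfl⟩, rfl⟩
    · exact ⟨y, ⟨-3, by decide, by rw [h1]; rfl, by rw [h2]; rfl⟩, rfl⟩

/-! ### The orders of the Weyl groups -/

theorem card_weylGroup_one (n : ℕ) : Nat.card (weylGroup 2 1 n) = (n + 1).factorial := by
  induction n with
  | zero =>
    have := weylGroup_zero_subsingleton 1
    simp
  | succ n ih =>
    have h : IsADE 1 (n + 1) := .inl ⟨rfl, by omega⟩
    rw [card_weylGroup_succ h.isAdmissible, ncard_zOrbit h, ncard_exceptional_one, ih,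
      Nat.factorial_succ (n + 1)]

theorem card_weylGroup_of_isEmpty_roots {m : ℤ} {n : ℕ} [IsEmpty (roots 2 m n)] :
    Nat.card (weylGroup 2 m n) = 1 := by
  rw [weylGroup, Set.range_eq_empty, Subgroup.closure_empty]
  simp

theorem card_weylGroup_two {n : ℕ} (hn : 1 ≤ n) :
    Nat.card (weylGroup 2 2 n) = 2 ^ (n - 1) * n.factorial := by
  induction n, hn using Nat.le_induction with
  | base =>
    have : IsEmpty (roots 2 2 1) := ⟨fun a => by
      obtain ⟨t, h1, h2⟩ := (mem_roots_iff two_ne_zero).1 a.2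
      simp only [Fin.sum_univ_one] at h1 h2
      rw [h1] at h2
      ring_nf at h2
      omega⟩
    rw [card_weylGroup_of_isEmpty_roots]
    rfl
  | succ n hn ih =>
    have h : IsADE 2 (n + 1) := .inr (.inl ⟨rfl, by omega⟩)
    rw [card_weylGroup_succ h.isAdmissible, ncard_zOrbit h, ncard_exceptional_two, ih,
      Nat.factorial_succ, Nat.add_sub_cancel]
    obtain ⟨k, rfl⟩ : ∃ k, n = k + 1 := ⟨n - 1, by omega⟩
    rw [Nat.add_sub_cancel, pow_succ]
    ring

/-- The only roots of `L_{2,3,2}` are `± (1, -1)`. -/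
theorem card_weylGroup_three_two : Nat.card (weylGroup 2 3 2) = 2 := by
  have hadm : IsAdmissible 3 2 := .inr (.inr ⟨rfl, by norm_num⟩)
  have hroot : ∀ a : roots 2 3 2, a.1 1 = -a.1 0 ∧ (a.1 0 = 1 ∨ a.1 0 = -1) := by
    intro a
    obtain ⟨t, h1, h2⟩ := (mem_roots_iff three_ne_zero).1 a.2
    rw [Fin.sum_univ_two] at h1 h2
    have h0 : 9 * t ^ 2 + (a.1 0 - a.1 1) ^ 2 = 2 * (2 + t ^ 2) := by
      linear_combination 2 * h2 - (a.1 0 + a.1 1 + 3 * t) * h1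
    have h3 : t ^ 2 < 1 := by linarith [sq_nonneg (a.1 0 - a.1 1)]
    obtain rfl : t = 0 := by nlinarith
    have h4 : a.1 1 = -a.1 0 := by linarith
    rw [h4] at h2
    exact ⟨h4, mul_self_eq_one_iff.1 (by linarith)⟩
  let α : roots 2 3 2 := ⟨![1, -1], (mem_roots_iff three_ne_zero).2 ⟨0, by simp, by simp⟩⟩
  have hrefl : ∀ a : roots 2 3 2, rootReflection a = rootReflection α := by
    intro a
    obtain ⟨h1, h2 | h2⟩ := hroot a
    · refine (rootFamily hadm).refl_eq_of_root_eq (i := a) (j := α) ?_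
      ext i
      fin_cases i <;> simp [rootFamily, toRat, α, h1, h2]
    · refine (rootFamily hadm).refl_eq_of_root_eq_neg (i := a) (j := α) ?_
      ext i
      fin_cases i <;> simp [rootFamily, toRat, α, h1, h2]
  have hrange : Set.range (rootReflection (k := 2) (m := 3) (n := 2)) = {rootReflection α} := by
    ext w
    constructor
    · rintro ⟨a, rfl⟩
      exact hrefl a
    · rintro rfl
      exact ⟨α, rfl⟩
  rw [weylGroup, hrange, ← Subgroup.zpowers_eq_closure, Nat.card_zpowers]
  refine orderOf_eq_prime ?_ ?_
  · rw [pow_two]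
    exact (rootFamily hadm).refl_mul_self α
  · intro h
    have h1 := (rootFamily hadm).refl_root_self α
    have h2 : (rootFamily hadm).refl α = 1 := h
    rw [h2] at h1
    have h3 := congrFun h1 0
    norm_num [rootFamily, toRat, α] at h3

theorem card_weylGroup_three_succ {n : ℕ} (h3 : 3 ≤ n + 1) (hn : n + 1 ≤ 8) :
    Nat.card (weylGroup 2 3 (n + 1)) =
      (exceptional 3 (n + 1)).ncard * Nat.card (weylGroup 2 3 n) := by
  have h : IsADE 3 (n + 1) := .inr (.inr ⟨rfl, h3, hn⟩)
  rw [card_weylGroup_succ h.isAdmissible, ncard_zOrbit h]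

theorem ncard_exceptional_three_three : (exceptional 3 3).ncard = 6 := by
  rw [ncard_exceptional_three (by norm_num)]
  decide +kernel

theorem ncard_exceptional_three_four : (exceptional 3 4).ncard = 10 := by
  rw [ncard_exceptional_three (by norm_num)]
  decide +kernel

theorem ncard_exceptional_three_five : (exceptional 3 5).ncard = 16 := by
  rw [ncard_exceptional_three (by norm_num)]
  decide +kernel

theorem ncard_exceptional_three_six : (exceptional 3 6).ncard = 27 := by
  rw [ncard_exceptional_three (by norm_num)]
  decide +kernel

theorem ncard_exceptional_three_seven : (exceptional 3 7).ncard = 56 := by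
  rw [ncard_exceptional_three (by norm_num)]
  decide +kernel

theorem ncard_exceptional_three_eight : (exceptional 3 8).ncard = 240 := by
  have h : IsAdmissible 3 (7 + 1) := .inr (.inr ⟨rfl, by norm_num⟩)
  rw [← Set.ncard_image_of_injective _ (orbitMap_injective h),
    orbitMap_image_exceptional_three_eight, Set.ncard_image_of_injective _ toRat_injective,
    ncard_roots_three_eight]

theorem card_weylGroup_three_three : Nat.card (weylGroup 2 3 3) = 12 := by
  rw [card_weylGroup_three_succ (by norm_num) (by norm_num), ncard_exceptional_three_three,
    card_weylGroup_three_two]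

theorem card_weylGroup_three_six : Nat.card (weylGroup 2 3 6) = 51840 := by
  rw [card_weylGroup_three_succ (by norm_num) (by norm_num), ncard_exceptional_three_six,
    card_weylGroup_three_succ (by norm_num) (by norm_num), ncard_exceptional_three_five,
    card_weylGroup_three_succ (by norm_num) (by norm_num), ncard_exceptional_three_four,
    card_weylGroup_three_three]

theorem card_weylGroup_three_seven : Nat.card (weylGroup 2 3 7) = 2903040 := by
  rw [card_weylGroup_three_succ (by norm_num) (by norm_num), ncard_exceptional_three_seven,
    card_weylGroup_three_six]

theorem card_weylGroup_three_eight : Nat.card (weylGroup 2 3 8) = 696729600 := by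
  rw [card_weylGroup_three_succ (by norm_num) (by norm_num), ncard_exceptional_three_eight,
    card_weylGroup_three_seven]

end CheckerboardLattice

open CheckerboardLattice in
theorem mainTheorem9 :
    -- the isotropy group of `z_{n+1}` in `W(X_{n+1})` is `W(X_n)`, and the resulting recursion
    (∀ (m : ℤ) (n : ℕ), IsADE m (n + 1) →
      (∃ φ : weylGroup 2 m n →* weylGroup 2 m (n + 1),
        Function.Injective φ ∧
        (∀ a : roots 2 m n, φ (weylReflection a) = weylReflection (extendRoot a)) ∧
        (∀ (w : weylGroup 2 m n) (x : Fin n → ℚ),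
          φ w • appendZero x = appendZero (w • x)) ∧
        φ.range =
          MulAction.stabilizer (weylGroup 2 m (n + 1)) (zVec 2 m (n + 1) (Fin.last n))) ∧
      Finite (weylGroup 2 m (n + 1)) ∧
      Nat.card (weylGroup 2 m (n + 1)) = (zOrbit m n).ncard * Nat.card (weylGroup 2 m n)) ∧
    -- type `A`
    (∀ n : ℕ, (zOrbit 1 n).ncard = (n + 1) + 1) ∧
    (∀ n : ℕ, 1 ≤ n → Nat.card (weylGroup 2 1 n) = (n + 1).factorial) ∧
    -- type `D`
    (∀ n : ℕ, 2 ≤ n + 1 → (zOrbit 2 n).ncard = 2 * (n + 1)) ∧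
    (∀ n : ℕ, 2 ≤ n → Nat.card (weylGroup 2 2 n) = 2 ^ (n - 1) * n.factorial) ∧
    -- type `E`
    Nat.card (weylGroup 2 3 3) = 12 ∧
    zOrbit 3 5 =
      {x | shape x = shapeOf 1 5 4 1 ∨ shape x = shapeOf (-2) 2 1 4 ∨
        shape x = shapeOf (-2) 5 1 1} ∧
    (zOrbit 3 5).ncard = 27 ∧
    Nat.card (weylGroup 2 3 6) = 27 * Nat.card (weylGroup 2 2 5) ∧
    Nat.card (weylGroup 2 3 6) = 51840 ∧
    zOrbit 3 6 =
      {x | shape x = shapeOf 1 6 3 1 ∨ shape x = shapeOf (-1) 2 1 5 ∨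
        shape x = shapeOf (-1) 5 1 2 ∨ shape x = shapeOf (-3) 1 (-1) 6} ∧
    (zOrbit 3 6).ncard = 56 ∧
    Nat.card (weylGroup 2 3 7) = 2903040 ∧
    zOrbit 3 7 = toRat '' roots 2 3 8 ∧
    (zOrbit 3 7).ncard = 240 ∧
    Nat.card (weylGroup 2 3 8) = 696729600 := by
  refine ⟨fun m n h => ⟨⟨weylExtend h.isAdmissible, weylExtend_injective _,
      fun a => Subtype.ext (extendHom_rootReflection h.isAdmissible a),
      fun w x => extendHom_appendZero _ w.1 x, range_weylExtend _⟩,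
      finite_weylGroup h.isAdmissible fun _ => finite_zOrbit,
      card_weylGroup_succ h.isAdmissible⟩, fun n => ?_, fun n _ => card_weylGroup_one n,
    fun n hn => ?_, fun n hn => card_weylGroup_two (by omega), card_weylGroup_three_three, ?_, ?_,
    ?_, card_weylGroup_three_six, ?_, ?_, card_weylGroup_three_seven, ?_, ?_,
    card_weylGroup_three_eight⟩
  · rw [ncard_zOrbit (.inl ⟨rfl, by omega⟩), ncard_exceptional_one]
  · rw [ncard_zOrbit (.inr (.inl ⟨rfl, hn⟩)), ncard_exceptional_two]
  · rw [zOrbit_eq (.inr (.inr ⟨rfl, by norm_num, by norm_num⟩)),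
      orbitMap_image_exceptional_three_six]
  · rw [ncard_zOrbit (.inr (.inr ⟨rfl, by norm_num, by norm_num⟩)), ncard_exceptional_three_six]
  · rw [card_weylGroup_three_six, card_weylGroup_two (by norm_num)]
    rfl
  · rw [zOrbit_eq (.inr (.inr ⟨rfl, by norm_num, by norm_num⟩)),
      orbitMap_image_exceptional_three_seven]
  · rw [ncard_zOrbit (.inr (.inr ⟨rfl, by norm_num, by norm_num⟩)), ncard_exceptional_three_seven]
  · rw [zOrbit_eq (.inr (.inr ⟨rfl, by norm_num, by norm_num⟩)),
      orbitMap_image_exceptional_three_eight]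
  · rw [ncard_zOrbit (.inr (.inr ⟨rfl, by norm_num, by norm_num⟩)), ncard_exceptional_three_eight]
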